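/- Let $G$ be a compact Lie group and let $\rho : G \to O(V)$ be a (continuous) representation of $G$ on a finite-dimensional real inner product space $V$, with orbit space $X = V/G$. Assume that $V = V_1 \oplus V_2$ is a $G$-invariant decomposition, write $\rho = \rho_1 \oplus \rho_2$, let $H_i$ be a principal isotropy group of $\rho_i$ (a minimal isotropy group of $\rho_i$ with respect to inclusion) for $i = 1, 2$, and put $Y_1 = V_1/\rho_1(H_2)$ and $Y_2 = V_2/\rho_2(H_1)$. Then $\partial X \neq \varnothing$ if and only if $\partial Y_1 \neq \varnothing$ or $\partial Y_2 \neq \varnothing$. Here, for an orthogonal representation of a compact Lie group $K$ on $W$, the stratum of $W/K$ through the orbit $Kp$ is the set of all orbits $Kq$ for which the isotropy group $K_q$ is conjugate to $K_p$ in $K$, and the boundary $\partial (W/K)$ is the closure of the union of all strata of codimension one in $W/K$. (In particular the orbit space of the zero representation, a point, has empty boundary.) -/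

import Mathlib

open scoped ContDiff Manifold

noncomputable section

/-- Velocities at `p` of smooth curves of `V` that lie in `S`. If `S` is an (embedded) submanifold
of `V` and `p ∈ S`, this is the tangent space of `S` at `p`. -/
def velocities {V : Type*} [NormedAddCommGroup V] [NormedSpace ℝ V] (S : Set V) (p : V) : Set V :=
  {v | ∃ γ : ℝ → V, ContDiff ℝ ∞ γ ∧ γ 0 = p ∧ (∀ t, γ t ∈ S) ∧ deriv γ 0 = v}

/-- The dimension at `p` of a submanifold `S` of `V`, as the dimension of its tangent space. -/
def dimAt {V : Type*} [NormedAddCommGroup V] [NormedSpace ℝ V] (S : Set V) (p : V) : ℕ :=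
  Module.finrank ℝ (Submodule.span ℝ (velocities S p))

namespace Representation

section Algebra

variable {G V : Type*} [Group G] [AddCommGroup V] [Module ℝ V]

/-- The isotropy group `G_p`. -/
def isotropyGroup (ρ : Representation ℝ G V) (p : V) : Subgroup G where
  carrier := {g | ρ g p = p}
  one_mem' := by simp
  mul_mem' := by
    intro a b ha hb
    simp only [Set.mem_ofPred_eq] at ha hb ⊢
    rw [map_mul, Module.End.mul_apply, hb, ha]
  inv_mem' := by
    intro a ha
    simp only [Set.mem_ofPred_eq] at ha ⊢
    conv_lhs => rw [← ha]
    simp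

/-- The orbit `Gp`. -/
def orbitSet (ρ : Representation ℝ G V) (p : V) : Set V :=
  Set.range fun g : G => ρ g p

/-- Two vectors are equivalent when they lie in the same orbit. -/
def orbitSetoid (ρ : Representation ℝ G V) : Setoid V where
  r v w := ∃ g : G, ρ g v = w
  iseqv :=
    { refl := fun v => ⟨1, by simp⟩
      symm := by
        rintro v w ⟨g, rfl⟩
        exact ⟨g⁻¹, by simp⟩
      trans := by
        rintro u v w ⟨g, rfl⟩ ⟨h, rfl⟩
        exact ⟨h * g, by simp⟩ }

/-- The orbit space `X = V/G`; when `V` is a topological space it carries the quotient topology. -/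
abbrev OrbitSpace (ρ : Representation ℝ G V) : Type _ := Quotient ρ.orbitSetoid

/-- The isotropy stratum of `p` in `V`: all vectors whose isotropy group is conjugate to `G_p`. -/
def isotropyStratum (ρ : Representation ℝ G V) (p : V) : Set V :=
  {q | ∃ g : G, ρ.isotropyGroup q = (ρ.isotropyGroup p).map (MulAut.conj g).toMonoidHom}

/-- The isotropy stratum of the orbit of `p` in the orbit space `X`: the image of the isotropy
stratum of `p` in `V`. -/
def orbitSpaceStratum (ρ : Representation ℝ G V) (p : V) : Set ρ.OrbitSpace :=
  (Quotient.mk ρ.orbitSetoid) '' ρ.isotropyStratum p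

/-- `H` is a principal isotropy group: it is an isotropy group, and it is minimal (with respect to
inclusion) among the isotropy groups of `ρ`. -/
def IsPrincipalIsotropyGroup (ρ : Representation ℝ G V) (H : Subgroup G) : Prop :=
  Minimal (fun K : Subgroup G => ∃ p : V, ρ.isotropyGroup p = K) H

end Algebra

section Boundary

variable {G V : Type*} [Group G] [NormedAddCommGroup V] [NormedSpace ℝ V]

/-- The dimension of the orbit space `X = V/G`: the least codimension of an orbit in `V`
(the codimension of the principal orbits). -/
def orbitSpaceDim (ρ : Representation ℝ G V) : ℕ :=
  ⨅ p : V, (Module.finrank ℝ V - dimAt (ρ.orbitSet p) p)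

/-- The dimension of the stratum of `X = V/G` through the orbit of `p`. The isotropy stratum of `p`
in `V` fibres over it, the fibres being the orbits, so its dimension is the difference of the
dimensions (the orbit of `p` lies in its isotropy stratum, so nothing is truncated). -/
def orbitSpaceStratumDim (ρ : Representation ℝ G V) (p : V) : ℕ :=
  dimAt (ρ.isotropyStratum p) p - dimAt (ρ.orbitSet p) p

/-- The stratum of `X = V/G` through the orbit of `p` has codimension one in `X`. -/
def HasCodimOneStratum (ρ : Representation ℝ G V) (p : V) : Prop :=
  ρ.orbitSpaceDim = ρ.orbitSpaceStratumDim p + 1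

/-- The boundary of `X = V/G`: the closure of the union of all strata of codimension one. -/
def orbitSpaceBoundary (ρ : Representation ℝ G V) : Set ρ.OrbitSpace :=
  closure (⋃ (p : V) (_ : ρ.HasCodimOneStratum p), ρ.orbitSpaceStratum p)

end Boundary

end Representation

end

/-! The boundary is nonempty exactly when some stratum has codimension one, so everything reduces to
comparing such strata of `ρ`, `ρ₁|H₂` and `ρ₂|H₁`.

Write N for the normal space of the orbit at p and F for the vectors of N fixed by G_p. The slice
theorem, in the form of `exists_isotropyGroup_add_le` and `exists_closest`, shows that the stratum
through p has dimension dim F (`orbitSpaceStratumDim_eq`) and that dim X is the cohomogeneity of G_p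
on N (`exists_orbitSpaceDim_add_eq`). Thus codimension one means that G_p acts on the orthogonal
complement of F in N with cohomogeneity one, which leaves no room for two orthogonal invariant
subspaces of N that are both moved by G_p (`le_fixedSpace_or_le_fixedSpace`).

If the second component of p has principal isotropy H₂, the slice representation at that component
is trivial. Then X looks near p like Y₁ times a Euclidean space, and the codimension one conditions
for p in X and for its first component in Y₁ agree (`hasCodimOneStratum_orthogonalSum_iff`). This
gives one implication, and symmetrically for Y₂.

For the converse, a codimension one stratum must contribute a point with one principal component.
Among all points p = (p₁, p₂) on codimension one strata, take one maximizing the sum of the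
dimensions of the fixed spaces of G_{p₁} in V₁ and G_{p₂} in V₂. The normal spaces of p₁ and p₂ are
orthogonal invariant subspaces of N, so G_p fixes one of them, say the first. Moving p₁ normally
then stays in the stratum, shrinks G_{p₁}, and so can only enlarge its fixed space. Maximality makes
the fixed space constant, so G_{p₁} acts trivially on its normal space, which means that it is
principal (`exists_hasCodimOneStratum_principal`).

The Lie theory is done inside End(V), for the compact image of G. -/

noncomputable section

open Filter Topology

/-! ### One-parameter groups in a Banach algebra as limits of powers. -/

section BanachAlgebra

variable {𝔸 : Type*} [NormedRing 𝔸] [NormedAlgebra ℝ 𝔸] [CompleteSpace 𝔸]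

theorem exp_add_smul (s t : ℝ) (A : 𝔸) :
    NormedSpace.exp ((s + t) • A) = NormedSpace.exp (s • A) * NormedSpace.exp (t • A) := by
  let _ : NormedAlgebra ℚ 𝔸 := NormedAlgebra.restrictScalars ℚ ℝ 𝔸
  rw [add_smul]
  exact NormedSpace.exp_add_of_commute (((Commute.refl A).smul_right t).smul_left s)

theorem exp_neg_smul_mul_exp_smul (t : ℝ) (A : 𝔸) :
    NormedSpace.exp ((-t) • A) * NormedSpace.exp (t • A) = 1 := by
  rw [← exp_add_smul]; simp

theorem exp_natCast_mul_smul (m : ℕ) (t : ℝ) (A : 𝔸) :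
    NormedSpace.exp ((m * t) • A) = NormedSpace.exp (t • A) ^ m := by
  induction m with
  | zero => simp
  | succ m ih => rw [pow_succ, ← ih, ← exp_add_smul]; congr 2; push_cast; ring

theorem contDiff_exp_smul (A : 𝔸) : ContDiff ℝ ∞ fun t : ℝ => NormedSpace.exp (t • A) := by
  have h : ∀ n : ℕ, ContDiff ℝ n fun t : ℝ => NormedSpace.exp (t • A) := by
    intro n
    induction n with
    | zero =>
      exact contDiff_zero.2 (continuous_iff_continuousAt.2
        fun t => (hasDerivAt_exp_smul_const A t).continuousAt)
    | succ n ih =>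
      rw [show ((n + 1 : ℕ) : WithTop ℕ∞) = n + 1 by push_cast; rfl, contDiff_succ_iff_deriv]
      refine ⟨fun t => (hasDerivAt_exp_smul_const A t).differentiableAt, by simp, ?_⟩
      have : deriv (fun t : ℝ => NormedSpace.exp (t • A)) =
          fun t : ℝ => NormedSpace.exp (t • A) * A :=
        funext fun t => (hasDerivAt_exp_smul_const A t).deriv
      rw [this]
      exact ih.mul contDiff_const
  exact contDiff_infty.2 h

theorem continuous_exp_smul (A : 𝔸) : Continuous fun t : ℝ => NormedSpace.exp (t • A) :=
  (contDiff_exp_smul A).continuous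

theorem tendsto_smul_exp_smul_sub_one {c : ℕ → ℝ} (hc : Tendsto c atTop atTop) (A : 𝔸) :
    Tendsto (fun n => c n • (NormedSpace.exp ((c n)⁻¹ • A) - 1)) atTop (𝓝 A) := by
  have hd : HasDerivAt (fun u : ℝ => NormedSpace.exp (u • A)) A 0 := by
    simpa using hasDerivAt_exp_smul_const A (0 : ℝ)
  have h0 : Tendsto (fun n => (c n)⁻¹) atTop (𝓝[≠] 0) := by
    refine tendsto_nhdsWithin_iff.2 ⟨tendsto_inv_atTop_zero.comp hc, ?_⟩
    filter_upwards [hc.eventually_gt_atTop 0] with n hn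
    simpa using hn.ne'
  have := hd.tendsto_slope_zero.comp h0
  simpa [Function.comp_def] using this

omit [NormedAlgebra ℝ 𝔸] [CompleteSpace 𝔸] in
-- Telescoping. Only the powers of `l` need a uniform bound, since those of the contraction `k` are
-- harmless.
theorem norm_pow_sub_pow_le {k l : 𝔸} {C : ℝ} (hk : ‖k‖ ≤ 1) {M : ℕ}
    (hl : ∀ m ≤ M, ‖l ^ m‖ ≤ C) : ∀ m ≤ M, ‖k ^ m - l ^ m‖ ≤ m * (‖k - l‖ * C) := by
  intro m
  induction m with
  | zero => simp
  | succ m ih =>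
    intro hm
    have h1 := ih (by omega)
    have h2 := hl m (by omega)
    have : k ^ (m + 1) - l ^ (m + 1) = k * (k ^ m - l ^ m) + (k - l) * l ^ m := by
      rw [pow_succ', pow_succ']; noncomm_ring
    rw [this]
    calc ‖k * (k ^ m - l ^ m) + (k - l) * l ^ m‖
        ≤ ‖k‖ * ‖k ^ m - l ^ m‖ + ‖k - l‖ * ‖l ^ m‖ :=
          (norm_add_le _ _).trans (add_le_add (norm_mul_le _ _) (norm_mul_le _ _))
      _ ≤ 1 * (m * (‖k - l‖ * C)) + ‖k - l‖ * C := by gcongr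
      _ = _ := by push_cast; ring

/-- If `kₙ` are contractions with `cₙ (kₙ - 1) → A`, `cₙ → ∞`, then suitable powers of `kₙ`
converge to `exp A`. -/
theorem tendsto_pow_exp {k : ℕ → 𝔸} {c : ℕ → ℝ} {A : 𝔸} (hk : ∀ n, ‖k n‖ ≤ 1)
    (hc : Tendsto c atTop atTop) (h : Tendsto (fun n => c n • (k n - 1)) atTop (𝓝 A)) :
    Tendsto (fun n => k n ^ ⌈c n⌉₊) atTop (𝓝 (NormedSpace.exp A)) := by
  set m : ℕ → ℕ := fun n => ⌈c n⌉₊ with hm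
  have hm_top : Tendsto (fun n => (m n : ℝ)) atTop atTop :=
    tendsto_atTop_mono (fun n => Nat.le_ceil (c n)) hc
  have h1 : Tendsto (fun n => (m n : ℝ) • (k n - 1)) atTop (𝓝 A) := by
    have h2 : Tendsto (fun n => ((m n : ℝ) / c n) • (c n • (k n - 1))) atTop (𝓝 ((1 : ℝ) • A)) :=
      ((tendsto_nat_ceil_div_atTop (R := ℝ)).comp hc).smul h
    rw [one_smul] at h2
    refine h2.congr' ?_
    filter_upwards [hc.eventually_gt_atTop 0] with n hn
    rw [smul_smul, div_mul_cancel₀ _ hn.ne']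
  -- `l n` is the exact m-th root of `exp A` in the one-parameter group. Both `k n` and `l n` are 1
  -- + A/m + o(1/m), so their m-th powers differ by o(1).
  set l : ℕ → 𝔸 := fun n => NormedSpace.exp ((m n : ℝ)⁻¹ • A) with hl
  have h3 := tendsto_smul_exp_smul_sub_one hm_top A
  have h4 : Tendsto (fun n => (m n : ℝ) * ‖k n - l n‖) atTop (𝓝 0) := by
    have := (h1.sub h3).norm
    simp only [sub_self, norm_zero] at this
    refine this.congr fun n => ?_
    rw [← smul_sub, norm_smul, Real.norm_natCast]
    congr 2
    simp [hl]
  obtain ⟨C, hC⟩ := (isCompact_Icc (a := (0 : ℝ)) (b := 1)).exists_bound_of_continuousOn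
    (continuous_exp_smul A).continuousOn
  have hlm : ∀ᶠ n in atTop, l n ^ m n = NormedSpace.exp A ∧ ∀ j ≤ m n, ‖l n ^ j‖ ≤ C := by
    filter_upwards [hm_top.eventually_gt_atTop 0] with n hn
    constructor
    · rw [← exp_natCast_mul_smul, mul_inv_cancel₀ hn.ne', one_smul]
    · intro j hj
      rw [← exp_natCast_mul_smul]
      refine hC _ ⟨by positivity, ?_⟩
      rw [← div_eq_mul_inv, div_le_one hn]
      exact_mod_cast hj
  rw [tendsto_iff_norm_sub_tendsto_zero]
  have h5 : Tendsto (fun n => (m n : ℝ) * ‖k n - l n‖ * C) atTop (𝓝 0) := by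
    simpa using h4.mul_const C
  refine squeeze_zero' (Eventually.of_forall fun n => norm_nonneg _) ?_ h5
  filter_upwards [hlm] with n hn
  rw [← hn.1, mul_assoc]
  exact norm_pow_sub_pow_le (hk n) hn.2 _ le_rfl

end BanachAlgebra

/-! ### Compact orthogonal representations and the Lie algebra of the image. -/

namespace Representation

variable {G V : Type*} [Group G] [NormedAddCommGroup V] [InnerProductSpace ℝ V]
  [FiniteDimensional ℝ V]

/-- The operator `ρ g` as a continuous linear map. -/
def toCLM (ρ : Representation ℝ G V) (g : G) : V →L[ℝ] V := LinearMap.toContinuousLinearMap (ρ g)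

@[simp]
theorem toCLM_apply (ρ : Representation ℝ G V) (g : G) (v : V) : ρ.toCLM g v = ρ g v := rfl

theorem toCLM_one (ρ : Representation ℝ G V) : ρ.toCLM 1 = 1 := by ext; simp

theorem toCLM_mul (ρ : Representation ℝ G V) (g h : G) :
    ρ.toCLM (g * h) = ρ.toCLM g * ρ.toCLM h := by ext; simp

theorem toCLM_pow (ρ : Representation ℝ G V) (g : G) (n : ℕ) :
    ρ.toCLM (g ^ n) = ρ.toCLM g ^ n := by
  induction n with
  | zero => simp [toCLM_one]
  | succ n ih => rw [pow_succ, pow_succ, toCLM_mul, ih]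

/-- An orthogonal representation with compact image. -/
structure IsCompactOrthogonal (ρ : Representation ℝ G V) : Prop where
  inner_map_map : ∀ (g : G) (v w : V), inner ℝ (ρ g v) (ρ g w) = inner ℝ v w
  isCompact_range : IsCompact (Set.range ρ.toCLM)

/-- The Lie algebra of the image of `ρ`. -/
def lieAlgebra (ρ : Representation ℝ G V) : Submodule ℝ (V →L[ℝ] V) :=
  Submodule.span ℝ {A | ∀ t : ℝ, NormedSpace.exp (t • A) ∈ Set.range ρ.toCLM}

omit [FiniteDimensional ℝ V] in
theorem apply_inv_apply (ρ : Representation ℝ G V) (g : G) (v : V) : ρ g (ρ g⁻¹ v) = v := by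
  simp

omit [FiniteDimensional ℝ V] in
theorem inv_apply_apply (ρ : Representation ℝ G V) (g : G) (v : V) : ρ g⁻¹ (ρ g v) = v := by
  simp

omit [FiniteDimensional ℝ V] in
theorem mem_isotropyGroup {ρ : Representation ℝ G V} {p : V} {g : G} :
    g ∈ ρ.isotropyGroup p ↔ ρ g p = p := Iff.rfl

namespace IsCompactOrthogonal

variable {ρ : Representation ℝ G V} (hρ : ρ.IsCompactOrthogonal)
include hρ

theorem norm_map (g : G) (v : V) : ‖ρ g v‖ = ‖v‖ := by
  rw [← sq_eq_sq₀ (norm_nonneg _) (norm_nonneg _), ← real_inner_self_eq_norm_sq,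
    ← real_inner_self_eq_norm_sq, hρ.inner_map_map]

theorem inner_map_left (g : G) (v w : V) : inner ℝ (ρ g v) w = inner ℝ v (ρ g⁻¹ w) := by
  rw [← hρ.inner_map_map g⁻¹, inv_apply_apply]

theorem norm_toCLM_le (g : G) : ‖ρ.toCLM g‖ ≤ 1 :=
  ContinuousLinearMap.opNorm_le_bound _ zero_le_one fun v => by simp [hρ.norm_map]

/-- Powers of image elements stay in the image, which is closed, so the limit in `tendsto_pow_exp`
belongs to it. Inverses handle negative times. -/
theorem exp_mem_range_of_tendsto {k : ℕ → V →L[ℝ] V} {c : ℕ → ℝ} {A : V →L[ℝ] V}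
    (hk : ∀ n, k n ∈ Set.range ρ.toCLM) (hc : Tendsto c atTop atTop)
    (h : Tendsto (fun n => c n • (k n - 1)) atTop (𝓝 A)) (t : ℝ) :
    NormedSpace.exp (t • A) ∈ Set.range ρ.toCLM := by
  have pos : ∀ t : ℝ, 0 < t → NormedSpace.exp (t • A) ∈ Set.range ρ.toCLM := by
    intro t ht
    have h1 := tendsto_pow_exp (k := k) (c := fun n => t * c n) (A := t • A)
      (fun n => by obtain ⟨g, hg⟩ := hk n; rw [← hg]; exact hρ.norm_toCLM_le g)
      (hc.const_mul_atTop ht) (by simpa [mul_smul] using h.const_smul t)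
    refine hρ.isCompact_range.isClosed.mem_of_tendsto h1 (Eventually.of_forall fun n => ?_)
    obtain ⟨g, hg⟩ := hk n
    exact ⟨g ^ ⌈t * c n⌉₊, by rw [toCLM_pow, hg]⟩
  rcases lt_trichotomy t 0 with ht | rfl | ht
  · obtain ⟨g, hg⟩ := pos (-t) (by linarith)
    refine ⟨g⁻¹, ?_⟩
    have h1 : ρ.toCLM g⁻¹ * ρ.toCLM g = 1 := by rw [← toCLM_mul]; simp [toCLM_one]
    have h2 := exp_neg_smul_mul_exp_smul t A
    rw [← hg] at h2
    exact left_inv_eq_right_inv h1 h2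
  · exact ⟨1, by simp [toCLM_one]⟩
  · exact pos t ht

/-- The spanning set is already a subspace. For sums, the elements exp(A/n) exp(B/n) approach the
identity in the direction A + B, so `exp_mem_range_of_tendsto` applies. -/
theorem mem_lieAlgebra {A : V →L[ℝ] V} :
    A ∈ ρ.lieAlgebra ↔ ∀ t : ℝ, NormedSpace.exp (t • A) ∈ Set.range ρ.toCLM := by
  refine ⟨fun h => ?_, fun h => Submodule.subset_span h⟩
  have hn : Tendsto (fun n : ℕ => (n : ℝ)) atTop atTop := tendsto_natCast_atTop_atTop
  induction h using Submodule.span_induction with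
  | mem A hA => exact hA
  | zero => intro t; exact ⟨1, by simp [toCLM_one]⟩
  | add A B _ _ hA hB =>
    refine hρ.exp_mem_range_of_tendsto (c := fun n => (n : ℝ))
      (k := fun n => NormedSpace.exp ((n : ℝ)⁻¹ • A) * NormedSpace.exp ((n : ℝ)⁻¹ • B)) ?_ hn ?_
    · intro n
      obtain ⟨g, hg⟩ := hA (n : ℝ)⁻¹
      obtain ⟨h, hh⟩ := hB (n : ℝ)⁻¹
      exact ⟨g * h, by rw [toCLM_mul, hg, hh]⟩
    · have h1 := tendsto_smul_exp_smul_sub_one hn A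
      have h2 := tendsto_smul_exp_smul_sub_one hn B
      have h3 : Tendsto (fun n : ℕ => NormedSpace.exp ((n : ℝ)⁻¹ • B)) atTop (𝓝 1) := by
        have := ((continuous_exp_smul B).tendsto 0).comp (tendsto_inv_atTop_zero.comp hn)
        simpa [Function.comp_def] using this
      have h4 := (h1.mul h3).add h2
      rw [mul_one] at h4
      refine h4.congr fun n => ?_
      rw [smul_mul_assoc, ← smul_add]
      congr 1
      noncomm_ring
  | smul a A _ hA => intro t; rw [smul_smul]; exact hA _

theorem exists_exp_eq {A : V →L[ℝ] V} (hA : A ∈ ρ.lieAlgebra) (t : ℝ) :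
    ∃ g, ρ.toCLM g = NormedSpace.exp (t • A) := hρ.mem_lieAlgebra.1 hA t

omit hρ in
theorem hasDerivAt_exp_smul_apply (A : V →L[ℝ] V) (t : ℝ) (v : V) :
    HasDerivAt (fun t : ℝ => NormedSpace.exp (t • A) v) (NormedSpace.exp (t • A) (A v)) t := by
  have := (hasDerivAt_exp_smul_const A t).clm_apply (hasDerivAt_const t v)
  simpa using this

omit hρ in
theorem hasDerivAt_exp_smul_apply_zero (A : V →L[ℝ] V) (v : V) :
    HasDerivAt (fun t : ℝ => NormedSpace.exp (t • A) v) (A v) 0 := by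
  simpa using hasDerivAt_exp_smul_apply A 0 v

omit hρ in
theorem exp_smul_apply_eq_self {A : V →L[ℝ] V} {v : V} (h : A v = 0) (t : ℝ) :
    NormedSpace.exp (t • A) v = v := by
  have := is_const_of_deriv_eq_zero (f := fun t : ℝ => NormedSpace.exp (t • A) v)
    (fun t => (hasDerivAt_exp_smul_apply A t v).differentiableAt)
    (fun t => by rw [(hasDerivAt_exp_smul_apply A t v).deriv, h, map_zero]) t 0
  simpa using this

omit hρ in
theorem apply_eq_zero_of_exp_smul {A : V →L[ℝ] V} {v : V}
    (h : ∀ t : ℝ, NormedSpace.exp (t • A) v = v) : A v = 0 := by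
  have h1 := hasDerivAt_exp_smul_apply_zero A v
  simp only [h] at h1
  exact h1.unique (hasDerivAt_const _ _)

theorem inner_lieAlgebra {A : V →L[ℝ] V} (hA : A ∈ ρ.lieAlgebra) (v w : V) :
    inner ℝ (A v) w = -inner ℝ v (A w) := by
  have h1 := (hasDerivAt_exp_smul_apply_zero A v).inner ℝ (hasDerivAt_exp_smul_apply_zero A w)
  have h2 : (fun t : ℝ => inner ℝ (NormedSpace.exp (t • A) v) (NormedSpace.exp (t • A) w)) =
      fun _ => inner ℝ v w := by
    funext t
    obtain ⟨g, hg⟩ := hρ.exists_exp_eq hA t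
    rw [← hg]
    exact hρ.inner_map_map g v w
  rw [h2] at h1
  have h3 := h1.unique (hasDerivAt_const _ _)
  simp at h3
  linarith

theorem inner_lieAlgebra_self {A : V →L[ℝ] V} (hA : A ∈ ρ.lieAlgebra) (v : V) :
    inner ℝ (A v) v = 0 := by
  have h1 := hρ.inner_lieAlgebra hA v v
  rw [real_inner_comm (A v) v] at h1
  linarith

/-- Conjugation commutes with the exponential, so it preserves one-parameter groups in the image. -/
theorem conj_mem_lieAlgebra {A : V →L[ℝ] V} (hA : A ∈ ρ.lieAlgebra) (g : G) :
    ρ.toCLM g * A * ρ.toCLM g⁻¹ ∈ ρ.lieAlgebra := by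
  have hg : ρ.toCLM g * ρ.toCLM g⁻¹ = 1 := by rw [← toCLM_mul]; simp [toCLM_one]
  have hg' : ρ.toCLM g⁻¹ * ρ.toCLM g = 1 := by rw [← toCLM_mul]; simp [toCLM_one]
  rw [hρ.mem_lieAlgebra] at hA ⊢
  intro t
  obtain ⟨h, hh⟩ := hA t
  refine ⟨g * h * g⁻¹, ?_⟩
  let _ : NormedAlgebra ℚ (V →L[ℝ] V) := NormedAlgebra.restrictScalars ℚ ℝ _
  have := NormedSpace.exp_units_conj (⟨ρ.toCLM g, ρ.toCLM g⁻¹, hg, hg'⟩ : (V →L[ℝ] V)ˣ) (t • A)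
  rw [toCLM_mul, toCLM_mul, hh]
  refine Eq.trans this.symm ?_
  congr 1
  simp

end IsCompactOrthogonal

end Representation

/-! ### Tangent spaces of orbits and the slice property. -/

namespace Representation

variable {G V : Type*} [Group G] [NormedAddCommGroup V] [InnerProductSpace ℝ V]
  [FiniteDimensional ℝ V]

namespace IsCompactOrthogonal

variable {ρ : Representation ℝ G V} (hρ : ρ.IsCompactOrthogonal)
include hρ

/-- Compactness of the image gives the coset of G_p a representative nearest to the identity.
Nearness rules out a limiting direction tangent to G_p. -/
theorem exists_minimal_representative (p : V) (g : G) :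
    ∃ g' : G, ρ g' p = ρ g p ∧
      ∀ h : G, ρ h p = ρ g p → ‖ρ.toCLM g' - 1‖ ≤ ‖ρ.toCLM h - 1‖ := by
  have hclosed : IsClosed {k : V →L[ℝ] V | k p = ρ g p} :=
    isClosed_eq (ContinuousLinearMap.apply ℝ V p).continuous continuous_const
  obtain ⟨k, ⟨⟨g', rfl⟩, hk2⟩, hk3⟩ := (hρ.isCompact_range.inter_right hclosed).exists_isMinOn
    ⟨ρ.toCLM g, ⟨g, rfl⟩, rfl⟩ (f := fun k => ‖k - 1‖) (by fun_prop)
  exact ⟨g', hk2, fun h hh => hk3 ⟨⟨h, rfl⟩, hh⟩⟩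

/-- If `gₙ p → p` with `gₙ p ≠ p`, then, along a subsequence and after multiplication by elements
of `G_p`, the `gₙ` approach the identity in a direction of the Lie algebra that moves `p`. -/
theorem exists_subseq_direction {p : V} {g : ℕ → G}
    (hg : Tendsto (fun n => ρ (g n) p) atTop (𝓝 p)) (hne : ∀ n, ρ (g n) p ≠ p) :
    ∃ (φ : ℕ → ℕ) (h : ℕ → G) (A : V →L[ℝ] V), StrictMono φ ∧ (∀ n, ρ (h n) p = p) ∧
      A ∈ ρ.lieAlgebra ∧ A p ≠ 0 ∧
      Tendsto (fun n => ‖ρ.toCLM (g (φ n) * h n) - 1‖⁻¹ • (ρ.toCLM (g (φ n) * h n) - 1))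
        atTop (𝓝 A) := by
  choose g' hg' hmin using fun n => hρ.exists_minimal_representative p (g n)
  obtain ⟨k, ⟨h₀, rfl⟩, φ₁, hφ₁, hk⟩ :=
    hρ.isCompact_range.tendsto_subseq (x := fun n => ρ.toCLM (g' n)) fun n => ⟨g' n, rfl⟩
  have hh₀ : ρ h₀ p = p := by
    have h1 : Tendsto (fun n => ρ.toCLM (g' (φ₁ n)) p) atTop (𝓝 (ρ.toCLM h₀ p)) :=
      ((ContinuousLinearMap.apply ℝ V p).continuous.tendsto _).comp hk
    have h2 : Tendsto (fun n => ρ.toCLM (g' (φ₁ n)) p) atTop (𝓝 p) := by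
      simpa [hg', Function.comp_def] using hg.comp hφ₁.tendsto_atTop
    exact tendsto_nhds_unique h1 h2
  have hh₀' : ρ h₀⁻¹ p = p := by conv_lhs => rw [← hh₀, inv_apply_apply]
  -- Right multiplication by the inverse of the limit h₀, which fixes p, gives representatives
  -- tending to the identity; the minimal ones are at least as close.
  have hD0 : Tendsto (fun n => ‖ρ.toCLM (g' (φ₁ n)) - 1‖) atTop (𝓝 0) := by
    have h1 : Tendsto (fun n => ‖ρ.toCLM (g' (φ₁ n)) * ρ.toCLM h₀⁻¹ - 1‖) atTop (𝓝 0) := by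
      have h2 := ((hk.mul_const (ρ.toCLM h₀⁻¹)).sub_const 1).norm
      rw [← toCLM_mul, mul_inv_cancel, toCLM_one, sub_self, norm_zero] at h2
      exact h2
    refine squeeze_zero (fun n => norm_nonneg _) (fun n => ?_) h1
    rw [← toCLM_mul]
    exact hmin _ _ (by rw [map_mul, Module.End.mul_apply, hh₀', hg'])
  have hDpos : ∀ n, 0 < ‖ρ.toCLM (g' n) - 1‖ := by
    intro n
    rw [norm_pos_iff, sub_ne_zero]
    intro h
    apply hne n
    rw [← hg' n, ← toCLM_apply, h]
    rfl
  obtain ⟨A, hA, φ₂, hφ₂, hlim⟩ := (isCompact_sphere (0 : V →L[ℝ] V) 1).tendsto_subseq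
    (x := fun n => ‖ρ.toCLM (g' (φ₁ n)) - 1‖⁻¹ • (ρ.toCLM (g' (φ₁ n)) - 1)) fun n => by
      rw [mem_sphere_zero_iff_norm, norm_smul, norm_inv, norm_norm,
        inv_mul_cancel₀ (hDpos _).ne']
  set φ := φ₁ ∘ φ₂ with hφdef
  set ε : ℕ → ℝ := fun n => ‖ρ.toCLM (g' (φ n)) - 1‖ with hε
  have hε0 : Tendsto ε atTop (𝓝 0) := hD0.comp hφ₂.tendsto_atTop
  have hεpos : ∀ n, 0 < ε n := fun n => hDpos _
  have hεinv : Tendsto (fun n => (ε n)⁻¹) atTop atTop :=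
    (tendsto_nhdsWithin_iff.2 ⟨hε0, Eventually.of_forall hεpos⟩).inv_tendsto_nhdsGT_zero
  have hlim' : Tendsto (fun n => (ε n)⁻¹ • (ρ.toCLM (g' (φ n)) - 1)) atTop (𝓝 A) := hlim
  have hAmem : A ∈ ρ.lieAlgebra := hρ.mem_lieAlgebra.2 fun t =>
    hρ.exp_mem_range_of_tendsto (fun n => ⟨_, rfl⟩) hεinv hlim' t
  refine ⟨φ, fun n => (g (φ n))⁻¹ * g' (φ n), A, hφ₁.comp hφ₂, fun n => ?_, hAmem, ?_, ?_⟩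
  · rw [map_mul, Module.End.mul_apply, hg', inv_apply_apply]
  -- If A killed p, exp(-εA) would fix p and g' exp(-εA) would be another representative. Its
  -- distance to the identity is o(ε), while minimality makes it at least ε.
  · intro hAp
    have h1 : Tendsto (fun n => (ε n)⁻¹ •
        (ρ.toCLM (g' (φ n)) * NormedSpace.exp ((ε n) • (-A)) - 1)) atTop (𝓝 0) := by
      have h2 := tendsto_smul_exp_smul_sub_one hεinv (-A)
      simp only [inv_inv] at h2
      have h3 : Tendsto (fun n => NormedSpace.exp ((ε n) • (-A))) atTop (𝓝 1) := by
        have := ((continuous_exp_smul (-A)).tendsto 0).comp hε0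
        simpa [Function.comp_def] using this
      have h4 := (hlim'.mul h3).add h2
      rw [mul_one, add_neg_cancel] at h4
      refine h4.congr fun n => ?_
      rw [smul_mul_assoc, ← smul_add]
      congr 1
      noncomm_ring
    have h5 : ∀ n, 1 ≤ ‖(ε n)⁻¹ •
        (ρ.toCLM (g' (φ n)) * NormedSpace.exp ((ε n) • (-A)) - 1)‖ := by
      intro n
      obtain ⟨h, hh⟩ := hρ.exists_exp_eq hAmem (-(ε n))
      have hh' : ρ h p = p := by
        rw [← toCLM_apply, hh, exp_smul_apply_eq_self hAp]
      rw [smul_neg, ← neg_smul, ← hh, ← toCLM_mul, norm_smul, norm_inv,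
        Real.norm_of_nonneg (hεpos n).le, ← div_eq_inv_mul, le_div_iff₀ (hεpos n), one_mul]
      exact hmin _ _ (by rw [map_mul, Module.End.mul_apply, hh', hg'])
    have h6 := ge_of_tendsto h1.norm (Eventually.of_forall h5)
    rw [norm_zero] at h6
    linarith
  · simpa only [mul_inv_cancel_left] using hlim'

/-- Difference quotients of orbit points have the directions D p of `exists_subseq_direction`, so
their limit is a multiple of A p. This identifies every velocity of the orbit with a Lie algebra
vector. -/
theorem mem_map_lieAlgebra_of_tendsto {p w : V} {g : ℕ → G} {c : ℕ → ℝ}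
    (hg : Tendsto (fun n => ρ (g n) p) atTop (𝓝 p))
    (h : Tendsto (fun n => c n • (ρ (g n) p - p)) atTop (𝓝 w)) :
    ∃ A ∈ ρ.lieAlgebra, A p = w := by
  by_cases hfreq : ∃ᶠ n in atTop, ρ (g n) p = p
  · refine ⟨0, zero_mem _, ?_⟩
    have : w ∈ ({0} : Set V) := isClosed_singleton.mem_of_frequently_of_tendsto
      (hfreq.mono fun n hn => by simp [hn]) h
    simpa using this.symm
  · rw [not_frequently, eventually_atTop] at hfreq
    obtain ⟨N, hN⟩ := hfreq
    obtain ⟨φ, k, A, hφ, hk, hA, hAp, hlim⟩ := hρ.exists_subseq_direction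
      (g := fun n => g (n + N)) (hg.comp (tendsto_add_atTop_nat N)) fun n => hN _ (by omega)
    set D := fun n => ρ.toCLM (g (φ n + N) * k n) - 1 with hD
    have hDp : ∀ n, D n p = ρ (g (φ n + N)) p - p := fun n => by simp [hD, hk]
    have h1 : Tendsto (fun n => ‖D n‖⁻¹ • D n p) atTop (𝓝 (A p)) :=
      ((ContinuousLinearMap.apply ℝ V p).continuous.tendsto _).comp hlim
    have hDne : ∀ n, ‖D n‖ ≠ 0 := by
      intro n h0
      rw [norm_eq_zero] at h0
      have := hDp n
      rw [h0] at this
      exact hN (φ n + N) (by omega) (sub_eq_zero.1 this.symm)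
    have h2 : Tendsto (fun n => (c (φ n + N) * ‖D n‖) • (‖D n‖⁻¹ • D n p)) atTop (𝓝 w) := by
      have := (h.comp (tendsto_add_atTop_nat N)).comp hφ.tendsto_atTop
      refine this.congr fun n => ?_
      rw [smul_smul, mul_assoc, mul_inv_cancel₀ (hDne n), mul_one, hDp]
      rfl
    have h3 : Tendsto (fun n => inner ℝ ((c (φ n + N) * ‖D n‖) • (‖D n‖⁻¹ • D n p))
        (‖D n‖⁻¹ • D n p) / inner ℝ (‖D n‖⁻¹ • D n p) (‖D n‖⁻¹ • D n p)) atTop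
        (𝓝 (inner ℝ w (A p) / inner ℝ (A p) (A p))) :=
      (h2.inner h1).div (h1.inner (𝕜 := ℝ) h1) (inner_self_ne_zero.2 hAp)
    -- As A p is nonzero, the scalar factors converge: they are recovered by pairing with the
    -- convergent directions.
    have h4 : Tendsto (fun n => c (φ n + N) * ‖D n‖) atTop
        (𝓝 (inner ℝ w (A p) / inner ℝ (A p) (A p))) := by
      refine h3.congr' ?_
      filter_upwards [(h1.inner (𝕜 := ℝ) h1).eventually_ne (inner_self_ne_zero.2 hAp)] with n hn
      rw [inner_smul_left, mul_div_assoc, div_self hn]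
      simp
    refine ⟨(inner ℝ w (A p) / inner ℝ (A p) (A p)) • A, Submodule.smul_mem _ _ hA, ?_⟩
    exact tendsto_nhds_unique (h4.smul h1) h2

end IsCompactOrthogonal

/-- The tangent space of the orbit of `p`, at `p`. -/
def tangentSpace (ρ : Representation ℝ G V) (p : V) : Submodule ℝ V :=
  Submodule.span ℝ (velocities (ρ.orbitSet p) p)

/-- The normal space of the orbit of `p`, at `p`. -/
def normalSpace (ρ : Representation ℝ G V) (p : V) : Submodule ℝ V := (ρ.tangentSpace p)ᗮ

/-- The vectors fixed by a subgroup. -/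
def fixedSpace (ρ : Representation ℝ G V) (H : Subgroup G) : Submodule ℝ V where
  carrier := {v | ∀ h ∈ H, ρ h v = v}
  add_mem' := fun ha hb h hh => by rw [map_add, ha h hh, hb h hh]
  zero_mem' := fun h _ => map_zero _
  smul_mem' := fun c v hv h hh => by rw [map_smul, hv h hh]

omit [FiniteDimensional ℝ V] in
theorem mem_fixedSpace {ρ : Representation ℝ G V} {H : Subgroup G} {v : V} :
    v ∈ ρ.fixedSpace H ↔ ∀ h ∈ H, ρ h v = v := Iff.rfl

omit [FiniteDimensional ℝ V] in
theorem mem_fixedSpace_iff_le {ρ : Representation ℝ G V} {H : Subgroup G} {v : V} :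
    v ∈ ρ.fixedSpace H ↔ H ≤ ρ.isotropyGroup v := Iff.rfl

omit [FiniteDimensional ℝ V] in
theorem self_mem_fixedSpace (ρ : Representation ℝ G V) (p : V) :
    p ∈ ρ.fixedSpace (ρ.isotropyGroup p) := fun _ h => h

omit [FiniteDimensional ℝ V] in
theorem fixedSpace_anti (ρ : Representation ℝ G V) {H K : Subgroup G} (h : H ≤ K) :
    ρ.fixedSpace K ≤ ρ.fixedSpace H := fun _ hv g hg => hv g (h hg)

/-- The normal vectors at `p` fixed by the isotropy group: the tangent directions of the
stratum of the orbit of `p` in the orbit space. -/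
def fixedNormalSpace (ρ : Representation ℝ G V) (p : V) : Submodule ℝ V :=
  ρ.normalSpace p ⊓ ρ.fixedSpace (ρ.isotropyGroup p)

namespace IsCompactOrthogonal

variable {ρ : Representation ℝ G V} (hρ : ρ.IsCompactOrthogonal)
include hρ

theorem tangentSpace_eq (p : V) :
    ρ.tangentSpace p =
      ρ.lieAlgebra.map (ContinuousLinearMap.apply ℝ V p).toLinearMap := by
  apply le_antisymm
  · refine Submodule.span_le.2 ?_
    rintro _ ⟨γ, hγ, rfl, hS, rfl⟩
    choose g hg using fun t => hS t
    have hn : Tendsto (fun n : ℕ => ((n : ℝ) + 1)⁻¹) atTop (𝓝 0) := by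
      simpa using tendsto_one_div_add_atTop_nhds_zero_nat (𝕜 := ℝ)
    have hd : HasDerivAt γ (deriv γ 0) 0 :=
      (hγ.differentiable (by simp)).differentiableAt.hasDerivAt
    obtain ⟨A, hA, hAp⟩ := hρ.mem_map_lieAlgebra_of_tendsto (p := γ 0) (w := deriv γ 0)
      (g := fun n : ℕ => g ((n : ℝ) + 1)⁻¹) (c := fun n : ℕ => (n : ℝ) + 1)
      (by simp only [hg]; exact (hγ.continuous.tendsto 0).comp hn) (by
        have h0 : Tendsto (fun n : ℕ => ((n : ℝ) + 1)⁻¹) atTop (𝓝[≠] 0) :=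
          tendsto_nhdsWithin_iff.2 ⟨hn, Eventually.of_forall fun n => by
            simp only [Set.mem_compl_iff, Set.mem_singleton_iff]; positivity⟩
        simpa [hg, Function.comp_def] using hd.tendsto_slope_zero.comp h0)
    exact ⟨A, hA, hAp⟩
  · rintro _ ⟨A, hA, rfl⟩
    refine Submodule.subset_span ⟨fun t : ℝ => NormedSpace.exp (t • A) p,
      (contDiff_exp_smul A).clm_apply contDiff_const, by simp, fun t => ?_,
      (hasDerivAt_exp_smul_apply_zero A p).deriv⟩
    obtain ⟨g, hg⟩ := hρ.exists_exp_eq hA t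
    exact ⟨g, by simp only [← hg]; rfl⟩

theorem mem_tangentSpace {p v : V} :
    v ∈ ρ.tangentSpace p ↔ ∃ A ∈ ρ.lieAlgebra, A p = v := by
  rw [hρ.tangentSpace_eq]; rfl

theorem mem_normalSpace {p v : V} :
    v ∈ ρ.normalSpace p ↔ ∀ A ∈ ρ.lieAlgebra, inner ℝ (A p) v = 0 := by
  rw [normalSpace, Submodule.mem_orthogonal, hρ.tangentSpace_eq]
  constructor
  · intro h A hA
    exact h _ ⟨A, hA, rfl⟩
  · rintro h _ ⟨A, hA, rfl⟩
    exact h A hA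

theorem map_mem_tangentSpace (g : G) {p v : V} (hv : v ∈ ρ.tangentSpace p) :
    ρ g v ∈ ρ.tangentSpace (ρ g p) := by
  obtain ⟨A, hA, rfl⟩ := hρ.mem_tangentSpace.1 hv
  exact hρ.mem_tangentSpace.2 ⟨_, hρ.conj_mem_lieAlgebra hA g, by simp⟩

theorem map_mem_normalSpace (g : G) {p v : V} (hv : v ∈ ρ.normalSpace p) :
    ρ g v ∈ ρ.normalSpace (ρ g p) := by
  rw [normalSpace, Submodule.mem_orthogonal'] at hv ⊢
  intro u hu
  rw [hρ.inner_map_left]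
  apply hv
  simpa using hρ.map_mem_tangentSpace g⁻¹ hu

/-- Near `p`, the isotropy groups along the normal slice are contained in `G_p`. -/
theorem exists_isotropyGroup_add_le (p : V) :
    ∃ ε > 0, ∀ v ∈ ρ.normalSpace p, ‖v‖ < ε → ρ.isotropyGroup (p + v) ≤ ρ.isotropyGroup p := by
  by_contra hcon
  push Not at hcon
  choose v hv hvn hle using fun n : ℕ => hcon (1 / ((n : ℝ) + 1)) Nat.one_div_pos_of_nat
  have hv0 : Tendsto (fun n => ‖v n‖) atTop (𝓝 0) :=
    squeeze_zero (fun n => norm_nonneg _) (fun n => (hvn n).le)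
      tendsto_one_div_add_atTop_nhds_zero_nat
  choose g hg hgp using fun n => SetLike.not_le_iff_exists.1 (hle n)
  simp only [mem_isotropyGroup] at hg hgp
  have hlim : Tendsto (fun n => ρ (g n) p) atTop (𝓝 p) := by
    rw [tendsto_iff_norm_sub_tendsto_zero]
    refine squeeze_zero (fun n => norm_nonneg _) (fun n => ?_)
      (g := fun n => ‖v n‖ + ‖v n‖) (by simpa using hv0.add hv0)
    have : ρ (g n) p - p = v n - ρ (g n) (v n) := by
      have := hg n
      rw [map_add] at this
      rw [sub_eq_sub_iff_add_eq_add, this, add_comm]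
    rw [this]
    exact (norm_sub_le _ _).trans (by rw [hρ.norm_map])
  obtain ⟨φ, h, A, hφ, hh, hA, hAp, hD⟩ := hρ.exists_subseq_direction hlim hgp
  set D := fun n => ρ.toCLM (g (φ n) * h n) - 1 with hDdef
  have hh' : ∀ n, ρ (h n)⁻¹ p = p := fun n => by
    conv_lhs => rw [← hh n, inv_apply_apply]
  set u : ℕ → V := fun n => ρ (h n)⁻¹ (v (φ n)) with hu
  have hun : ∀ n, u n ∈ ρ.normalSpace p := fun n => by
    have := hρ.map_mem_normalSpace (h n)⁻¹ (hv (φ n))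
    rwa [hh'] at this
  have hu0 : Tendsto u atTop (𝓝 0) := by
    rw [tendsto_zero_iff_norm_tendsto_zero]
    simp only [hu, hρ.norm_map]
    exact hv0.comp hφ.tendsto_atTop
  -- Rewriting g(p + v) = p + v with h u = v. Paired with A p, the terms v and u vanish because they
  -- are normal at p, and D u is negligible against ‖D‖ because u tends to 0. In the limit A p is
  -- orthogonal to itself.
  have key : ∀ n, D n p = v (φ n) - u n - D n (u n) := by
    intro n
    have h1 : ρ (g (φ n)) (ρ (h n) (p + u n)) = p + v (φ n) := by
      rw [map_add, hh, hu]
      simp only [apply_inv_apply]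
      exact hg _
    simp only [hDdef, sub_apply, toCLM_apply, map_mul, Module.End.mul_apply,
      one_apply_eq_self, hh]
    rw [map_add, map_add, hh] at h1
    rw [sub_sub_sub_cancel_right, sub_eq_sub_iff_add_eq_add, h1, add_comm]
  have hDp : Tendsto (fun n => inner ℝ (A p) ((‖D n‖⁻¹ • D n) p)) atTop
      (𝓝 (inner ℝ (A p) (A p))) :=
    tendsto_const_nhds.inner (((ContinuousLinearMap.apply ℝ V p).continuous.tendsto _).comp hD)
  have hDu : Tendsto (fun n => inner ℝ (A p) ((‖D n‖⁻¹ • D n) (u n))) atTop (𝓝 0) := by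
    have h1 : Tendsto (fun n => (‖D n‖⁻¹ • D n) (u n)) atTop (𝓝 (A 0)) :=
      ((isBoundedBilinearMap_apply (𝕜 := ℝ) (E := V) (F := V)).continuous.tendsto (A, 0)).comp
        (hD.prodMk_nhds hu0)
    simpa using (tendsto_const_nhds (x := A p)).inner (𝕜 := ℝ) h1
  have heq : ∀ n, inner ℝ (A p) ((‖D n‖⁻¹ • D n) p) =
      -inner ℝ (A p) ((‖D n‖⁻¹ • D n) (u n)) := by
    intro n
    have h1 := hρ.mem_normalSpace.1 (hv (φ n)) A hA
    have h2 := hρ.mem_normalSpace.1 (hun n) A hA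
    rw [smul_apply, smul_apply, key, inner_smul_right,
      inner_smul_right, inner_sub_right, inner_sub_right, h1, h2]
    ring
  simp only [heq] at hDp
  have := tendsto_nhds_unique hDp hDu.neg
  rw [neg_zero, inner_self_eq_zero] at this
  exact hAp this

/-- Every orbit contains a point closest to `p`, and its difference to `p` is normal at `p`. -/
theorem exists_closest (p q : V) :
    ∃ g : G, (∀ h : G, ‖ρ g q - p‖ ≤ ‖ρ h q - p‖) ∧ ρ g q - p ∈ ρ.normalSpace p := by
  obtain ⟨k, ⟨g, rfl⟩, hk⟩ := hρ.isCompact_range.exists_isMinOn ⟨ρ.toCLM 1, 1, rfl⟩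
    (f := fun k => ‖k q - p‖) (by fun_prop)
  have hmin : ∀ h : G, ‖ρ g q - p‖ ≤ ‖ρ h q - p‖ := fun h => hk ⟨h, rfl⟩
  refine ⟨g, hmin, hρ.mem_normalSpace.2 fun A hA => ?_⟩
  set q' := ρ g q
  have hd : HasDerivAt (fun t : ℝ => inner ℝ (NormedSpace.exp (t • A) q' - p)
      (NormedSpace.exp (t • A) q' - p)) (inner ℝ (q' - p) (A q') + inner ℝ (A q') (q' - p)) 0 := by
    have h1 := (hasDerivAt_exp_smul_apply_zero A q').sub_const p
    simpa using h1.inner ℝ h1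
  have hloc : IsLocalMin (fun t : ℝ => inner ℝ (NormedSpace.exp (t • A) q' - p)
      (NormedSpace.exp (t • A) q' - p)) 0 := by
    refine Eventually.of_forall fun t => ?_
    obtain ⟨h, hh⟩ := hρ.exists_exp_eq hA t
    simp only [zero_smul, NormedSpace.exp_zero, one_apply_eq_self,
      real_inner_self_eq_norm_sq]
    gcongr
    rw [← hh]
    have := hmin (h * g)
    rwa [map_mul, Module.End.mul_apply] at this
  have h0 := hloc.hasDerivAt_eq_zero hd
  rw [real_inner_comm (A q'), inner_sub_right, hρ.inner_lieAlgebra_self hA,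
    hρ.inner_lieAlgebra hA, real_inner_comm] at h0
  rw [inner_sub_right, hρ.inner_lieAlgebra_self hA]
  linarith

/-- The isotropy group at an interior point of a shortest segment between two orbits fixes the
end point. -/
theorem isotropyGroup_segment_le {p q : V} (hmin : ∀ h : G, ‖q - p‖ ≤ ‖ρ h q - p‖) {t : ℝ}
    (ht : t ∈ Set.Ioo (0 : ℝ) 1) :
    ρ.isotropyGroup (p + t • (q - p)) ≤ ρ.isotropyGroup q := by
  intro g hg
  rw [mem_isotropyGroup] at hg ⊢
  set x := p + t • (q - p) with hx
  have h1 : q - x = (1 - t) • (q - p) := by rw [hx]; module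
  have h2 : x - p = t • (q - p) := by rw [hx]; module
  have h3 : ‖ρ g q - x‖ = (1 - t) * ‖q - p‖ := by
    conv_lhs => rw [← hg]
    rw [← map_sub, hρ.norm_map, h1, norm_smul, Real.norm_of_nonneg (by linarith [ht.2])]
  have h4 : ‖x - p‖ = t * ‖q - p‖ := by rw [h2, norm_smul, Real.norm_of_nonneg ht.1.le]
  -- The broken path from p through x to g q has length ‖q - p‖, which is at most the distance from
  -- p to g q. Equality in the triangle inequality puts g q on the ray from p through x, at the
  -- position of q.
  have h5 : ‖(ρ g q - x) + (x - p)‖ = ‖ρ g q - x‖ + ‖x - p‖ := by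
    refine le_antisymm (norm_add_le _ _) ?_
    rw [sub_add_sub_cancel, h3, h4]
    linarith [hmin g]
  have h6 : SameRay ℝ (ρ g q - x) (x - p) := sameRay_iff_norm_add.2 h5
  have h7 := h6.norm_smul_eq
  rw [h3, h4, h2, smul_smul, ← smul_smul] at h7
  by_cases hqp : ‖q - p‖ = 0
  · rw [norm_eq_zero, sub_eq_zero] at hqp
    have hxp : x = q := by rw [hx, hqp]; simp
    rwa [hxp] at hg
  · have h8 : ρ g q - x = q - x := by
      rw [h1]
      have ht0 : t * ‖q - p‖ ≠ 0 := mul_ne_zero ht.1.ne' hqp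
      refine smul_right_injective V ht0 ?_
      simp only
      rw [← h7]
      module
    exact sub_left_injective h8

end IsCompactOrthogonal

end Representation

/-! ### Invariance under injective linear maps and under the group. -/

theorem finrank_map_of_injective {E F : Type*} [AddCommGroup E] [Module ℝ E] [AddCommGroup F]
    [Module ℝ F] {f : E →ₗ[ℝ] F} (hf : Function.Injective f) (N : Submodule ℝ E) :
    Module.finrank ℝ (N.map f) = Module.finrank ℝ N :=
  (N.equivMapOfInjective f hf).finrank_eq.symm

section Velocities

variable {V W : Type*} [NormedAddCommGroup V] [NormedSpace ℝ V] [FiniteDimensional ℝ V]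
  [NormedAddCommGroup W] [NormedSpace ℝ W] [FiniteDimensional ℝ W]

theorem velocities_image (f : V →ₗ[ℝ] W) (hf : Function.Injective f) (S : Set V) (p : V) :
    velocities (f '' S) (f p) = f '' velocities S p := by
  obtain ⟨r, hr⟩ := f.exists_leftInverse_of_injective (LinearMap.ker_eq_bot.2 hf)
  have hrf : ∀ v, r (f v) = v := fun v => LinearMap.congr_fun hr v
  have hd : ∀ γ : ℝ → V, ContDiff ℝ ∞ γ → deriv (fun t => f (γ t)) 0 = f (deriv γ 0) := by
    intro γ hγ
    have h1 : HasDerivAt γ (deriv γ 0) 0 :=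
      (hγ.differentiable (by simp)).differentiableAt.hasDerivAt
    exact ((LinearMap.toContinuousLinearMap f).hasFDerivAt.comp_hasDerivAt 0 h1).deriv
  apply Set.Subset.antisymm
  · rintro _ ⟨γ, hγ, h0, hS, rfl⟩
    have hγ' : ContDiff ℝ ∞ fun t => r (γ t) :=
      (LinearMap.toContinuousLinearMap r).contDiff.comp hγ
    have hfr : (fun t => f (r (γ t))) = γ := by
      funext t
      obtain ⟨s, _, hs⟩ := hS t
      rw [← hs, hrf]
    refine ⟨deriv (fun t => r (γ t)) 0, ⟨_, hγ', by simp only [h0, hrf], fun t => ?_, rfl⟩, ?_⟩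
    · obtain ⟨s, hsS, hs⟩ := hS t
      simpa only [← hs, hrf] using hsS
    · rw [← hd _ hγ', hfr]
  · rintro _ ⟨_, ⟨γ, hγ, rfl, hS, rfl⟩, rfl⟩
    exact ⟨fun t => f (γ t), (LinearMap.toContinuousLinearMap f).contDiff.comp hγ, rfl,
      fun t => ⟨_, hS t, rfl⟩, hd γ hγ⟩

theorem span_velocities_image (f : V →ₗ[ℝ] W) (hf : Function.Injective f) (S : Set V) (p : V) :
    Submodule.span ℝ (velocities (f '' S) (f p)) =
      (Submodule.span ℝ (velocities S p)).map f := by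
  rw [velocities_image f hf, Submodule.map_span]

theorem dimAt_image (f : V →ₗ[ℝ] W) (hf : Function.Injective f) (S : Set V) (p : V) :
    dimAt (f '' S) (f p) = dimAt S p := by
  rw [dimAt, span_velocities_image f hf, finrank_map_of_injective hf]; rfl

end Velocities

namespace Representation

section Conjugation

variable {G V : Type*} [Group G] [AddCommGroup V] [Module ℝ V] (ρ : Representation ℝ G V)

theorem isotropyGroup_apply (g : G) (p : V) :
    ρ.isotropyGroup (ρ g p) = (ρ.isotropyGroup p).map (MulAut.conj g).toMonoidHom := by
  ext h
  rw [Subgroup.mem_map]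
  constructor
  · intro hh
    refine ⟨g⁻¹ * h * g, ?_, by simp [mul_assoc]⟩
    change ρ h (ρ g p) = ρ g p at hh
    change ρ (g⁻¹ * h * g) p = p
    simp [map_mul, hh]
  · rintro ⟨k, hk, rfl⟩
    change ρ k p = p at hk
    change ρ (g * k * g⁻¹) (ρ g p) = ρ g p
    simp [map_mul, hk]

theorem mem_isotropyStratum_iff {p q : V} :
    q ∈ ρ.isotropyStratum p ↔ ∃ g, ρ.isotropyGroup q = ρ.isotropyGroup (ρ g p) := by
  simp only [isotropyGroup_apply]; rfl

theorem orbitSet_apply (g : G) (p : V) : ρ.orbitSet (ρ g p) = ρ g '' ρ.orbitSet p := by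
  ext q
  constructor
  · rintro ⟨h, rfl⟩
    exact ⟨ρ (g⁻¹ * h * g) p, ⟨_, rfl⟩, by simp [map_mul]⟩
  · rintro ⟨_, ⟨h, rfl⟩, rfl⟩
    exact ⟨g * h * g⁻¹, by simp [map_mul]⟩

theorem isotropyStratum_apply (g : G) (p : V) :
    ρ.isotropyStratum (ρ g p) = ρ g '' ρ.isotropyStratum p := by
  ext q
  simp only [Set.mem_image, mem_isotropyStratum_iff]
  constructor
  · rintro ⟨h, hh⟩
    refine ⟨ρ g⁻¹ q, ⟨g⁻¹ * h * g, ?_⟩, by simp⟩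
    rw [isotropyGroup_apply, hh, map_mul, map_mul, Module.End.mul_apply, Module.End.mul_apply,
      ← isotropyGroup_apply]
  · rintro ⟨r, ⟨h, hh⟩, rfl⟩
    refine ⟨g * h * g⁻¹, ?_⟩
    rw [isotropyGroup_apply, hh, ← isotropyGroup_apply, map_mul, map_mul, Module.End.mul_apply,
      Module.End.mul_apply]
    simp

theorem apply_injective (g : G) : Function.Injective (ρ g) :=
  Function.LeftInverse.injective (g := ρ g⁻¹) fun v => by simp

end Conjugation

variable {G V : Type*} [Group G] [NormedAddCommGroup V] [InnerProductSpace ℝ V]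
  [FiniteDimensional ℝ V]

theorem hasCodimOneStratum_apply_iff (ρ : Representation ℝ G V) (g : G) (p : V) :
    ρ.HasCodimOneStratum (ρ g p) ↔ ρ.HasCodimOneStratum p := by
  rw [HasCodimOneStratum, HasCodimOneStratum, orbitSpaceStratumDim, orbitSpaceStratumDim,
    orbitSet_apply, isotropyStratum_apply, dimAt_image _ (ρ.apply_injective g),
    dimAt_image _ (ρ.apply_injective g)]

theorem tangentSpace_apply (ρ : Representation ℝ G V) (g : G) (p : V) :
    ρ.tangentSpace (ρ g p) = (ρ.tangentSpace p).map (ρ g) := by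
  rw [tangentSpace, orbitSet_apply, span_velocities_image _ (ρ.apply_injective g)]; rfl

theorem finrank_tangentSpace_apply (ρ : Representation ℝ G V) (g : G) (p : V) :
    Module.finrank ℝ (ρ.tangentSpace (ρ g p)) = Module.finrank ℝ (ρ.tangentSpace p) := by
  rw [tangentSpace_apply, finrank_map_of_injective (ρ.apply_injective g)]

omit [FiniteDimensional ℝ V] in
theorem fixedSpace_isotropyGroup_apply (ρ : Representation ℝ G V) (g : G) (p : V) :
    ρ.fixedSpace (ρ.isotropyGroup (ρ g p)) = (ρ.fixedSpace (ρ.isotropyGroup p)).map (ρ g) := by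
  ext v
  simp only [Submodule.mem_map, mem_fixedSpace, isotropyGroup_apply, Subgroup.mem_map]
  constructor
  · intro h
    refine ⟨ρ g⁻¹ v, fun k hk => ?_, by simp⟩
    have := h (g * k * g⁻¹) ⟨k, hk, rfl⟩
    conv_rhs => rw [← this]
    simp [map_mul]
  · rintro ⟨w, hw, rfl⟩ _ ⟨k, hk, rfl⟩
    have := hw k hk
    simp [map_mul, this]

/-- An isotropy group contained in a conjugate of itself is equal to it. -/
theorem isotropyGroup_apply_eq_of_le (ρ : Representation ℝ G V) {g : G} {p : V}
    (h : ρ.isotropyGroup (ρ g p) ≤ ρ.isotropyGroup p) :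
    ρ.isotropyGroup (ρ g p) = ρ.isotropyGroup p := by
  refine le_antisymm h ?_
  -- Conjugate groups have fixed spaces of the same dimension, so nested ones coincide. The groups
  -- are then equal because each isotropy group is determined by a point of its own fixed space.
  have h1 : ρ.fixedSpace (ρ.isotropyGroup p) = ρ.fixedSpace (ρ.isotropyGroup (ρ g p)) := by
    refine Submodule.eq_of_le_of_finrank_eq (ρ.fixedSpace_anti h) ?_
    rw [fixedSpace_isotropyGroup_apply, finrank_map_of_injective
      (ρ.apply_injective g)]
  have h2 := ρ.self_mem_fixedSpace (ρ g p)
  rw [← h1] at h2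
  exact h2

theorem isotropyGroup_eq_apply_of_le (ρ : Representation ℝ G V) {g : G} {p : V}
    (h : ρ.isotropyGroup p ≤ ρ.isotropyGroup (ρ g p)) :
    ρ.isotropyGroup p = ρ.isotropyGroup (ρ g p) := by
  have := ρ.isotropyGroup_apply_eq_of_le (g := g⁻¹) (p := ρ g p) (by rwa [inv_apply_apply])
  rwa [inv_apply_apply] at this

/-- The restriction of a representation to a subgroup. -/
abbrev restrictSubgroup (ρ : Representation ℝ G V) (H : Subgroup G) : Representation ℝ H V :=
  ρ.comp H.subtype

omit [FiniteDimensional ℝ V] in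
@[simp]
theorem restrictSubgroup_apply (ρ : Representation ℝ G V) (H : Subgroup G) (h : H) (v : V) :
    ρ.restrictSubgroup H h v = ρ (h : G) v := rfl

theorem finrank_tangentSpace_add_finrank_normalSpace (ρ : Representation ℝ G V) (p : V) :
    Module.finrank ℝ (ρ.tangentSpace p) + Module.finrank ℝ (ρ.normalSpace p) =
      Module.finrank ℝ V :=
  Submodule.finrank_add_finrank_orthogonal _

theorem orbitSpaceDim_le (ρ : Representation ℝ G V) (p : V) :
    ρ.orbitSpaceDim ≤ Module.finrank ℝ (ρ.normalSpace p) := by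
  have h1 : ρ.orbitSpaceDim ≤ Module.finrank ℝ V - Module.finrank ℝ (ρ.tangentSpace p) :=
    ciInf_le (OrderBot.bddBelow _) p
  have := ρ.finrank_tangentSpace_add_finrank_normalSpace p
  omega

theorem exists_orbitSpaceDim_eq (ρ : Representation ℝ G V) :
    ∃ p, ρ.orbitSpaceDim = Module.finrank ℝ (ρ.normalSpace p) := by
  obtain ⟨p, hp⟩ := Nat.sInf_mem (Set.range_nonempty
    fun p : V => Module.finrank ℝ V - dimAt (ρ.orbitSet p) p)
  have h1 : ρ.orbitSpaceDim = Module.finrank ℝ V - Module.finrank ℝ (ρ.tangentSpace p) := hp.symm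
  have := ρ.finrank_tangentSpace_add_finrank_normalSpace p
  exact ⟨p, by omega⟩

theorem finrank_map_add_finrank_inf_ker {E F : Type*} [AddCommGroup E] [Module ℝ E]
    [FiniteDimensional ℝ E] [AddCommGroup F] [Module ℝ F] (f : E →ₗ[ℝ] F) (N : Submodule ℝ E) :
    Module.finrank ℝ (N.map f) + Module.finrank ℝ (N ⊓ LinearMap.ker f : Submodule ℝ E) =
      Module.finrank ℝ N := by
  rw [← (f.domRestrict N).finrank_range_add_finrank_ker, LinearMap.range_domRestrict]
  congr 1
  rw [LinearMap.ker_domRestrict, ← finrank_map_of_injective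
    N.injective_subtype, Submodule.map_comap_subtype]

/-! ### Dimensions of the orbit space and its strata through the slice representation. -/

namespace IsCompactOrthogonal

variable {ρ : Representation ℝ G V} (hρ : ρ.IsCompactOrthogonal)
include hρ

theorem restrict_isotropyGroup (p : V) :
    (ρ.restrictSubgroup (ρ.isotropyGroup p)).IsCompactOrthogonal where
  inner_map_map g v w := hρ.inner_map_map g v w
  isCompact_range := by
    have hclosed : IsClosed {k : V →L[ℝ] V | k p = p} :=
      isClosed_eq (ContinuousLinearMap.apply ℝ V p).continuous continuous_const
    convert hρ.isCompact_range.inter_right hclosed using 1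
    ext k
    constructor
    · rintro ⟨⟨g, hg⟩, rfl⟩
      exact ⟨⟨g, rfl⟩, hg⟩
    · rintro ⟨⟨g, rfl⟩, hg⟩
      exact ⟨⟨g, hg⟩, rfl⟩

theorem mem_lieAlgebra_restrict {p : V} {A : V →L[ℝ] V} :
    A ∈ (ρ.restrictSubgroup (ρ.isotropyGroup p)).lieAlgebra ↔ A ∈ ρ.lieAlgebra ∧ A p = 0 := by
  rw [(hρ.restrict_isotropyGroup p).mem_lieAlgebra, hρ.mem_lieAlgebra]
  constructor
  · intro h
    refine ⟨fun t => ?_, apply_eq_zero_of_exp_smul fun t => ?_⟩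
    · obtain ⟨g, hg⟩ := h t
      exact ⟨g, hg⟩
    · obtain ⟨g, hg⟩ := h t
      rw [← hg]
      exact g.2
  · rintro ⟨h, hp⟩ t
    obtain ⟨g, hg⟩ := h t
    refine ⟨⟨g, ?_⟩, hg⟩
    rw [mem_isotropyGroup, ← toCLM_apply, hg, exp_smul_apply_eq_self hp]

/-- Rank-nullity for evaluation at p on the Lie algebra: the kernel is the Lie algebra of G_p. -/
theorem finrank_tangentSpace_add (p : V) :
    Module.finrank ℝ (ρ.tangentSpace p) +
      Module.finrank ℝ (ρ.restrictSubgroup (ρ.isotropyGroup p)).lieAlgebra =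
      Module.finrank ℝ ρ.lieAlgebra := by
  rw [hρ.tangentSpace_eq, ← finrank_map_add_finrank_inf_ker
    (ContinuousLinearMap.apply ℝ V p).toLinearMap ρ.lieAlgebra]
  have h : (ρ.restrictSubgroup (ρ.isotropyGroup p)).lieAlgebra = ρ.lieAlgebra ⊓
      LinearMap.ker (ContinuousLinearMap.apply ℝ V p).toLinearMap := by
    ext A
    exact hρ.mem_lieAlgebra_restrict
  rw [h]

theorem finrank_tangentSpace_le_of_isotropyGroup_le {p q : V}
    (h : ρ.isotropyGroup p ≤ ρ.isotropyGroup q) :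
    Module.finrank ℝ (ρ.tangentSpace q) ≤ Module.finrank ℝ (ρ.tangentSpace p) := by
  have hle : (ρ.restrictSubgroup (ρ.isotropyGroup p)).lieAlgebra ≤
      (ρ.restrictSubgroup (ρ.isotropyGroup q)).lieAlgebra := by
    intro A hA
    refine hρ.mem_lieAlgebra_restrict.2 ⟨(hρ.mem_lieAlgebra_restrict.1 hA).1,
      apply_eq_zero_of_exp_smul fun t => ?_⟩
    obtain ⟨g, hg⟩ := (hρ.restrict_isotropyGroup p).exists_exp_eq hA t
    rw [← hg]
    exact h g.2
  have h1 := hρ.finrank_tangentSpace_add p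
  have h2 := hρ.finrank_tangentSpace_add q
  have h3 := Submodule.finrank_mono hle
  omega

theorem tangentSpace_smul (p : V) {c : ℝ} (hc : c ≠ 0) :
    ρ.tangentSpace (c • p) = ρ.tangentSpace p := by
  ext v
  rw [hρ.mem_tangentSpace, hρ.mem_tangentSpace]
  constructor
  · rintro ⟨A, hA, rfl⟩
    exact ⟨c • A, Submodule.smul_mem _ _ hA, by simp⟩
  · rintro ⟨A, hA, rfl⟩
    exact ⟨c⁻¹ • A, Submodule.smul_mem _ _ hA, by simp [smul_smul, hc]⟩

/-- By the slice property, the Lie algebra of G_{p+v} is the stabilizer of v in that of G_p.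
Counting dimensions with `finrank_tangentSpace_add` gives the formula. -/
theorem exists_finrank_tangentSpace_add_eq (p : V) :
    ∃ ε > 0, ∀ v ∈ ρ.normalSpace p, ‖v‖ < ε →
      Module.finrank ℝ (ρ.tangentSpace (p + v)) = Module.finrank ℝ (ρ.tangentSpace p) +
        Module.finrank ℝ ((ρ.restrictSubgroup (ρ.isotropyGroup p)).tangentSpace v) := by
  obtain ⟨ε, hε, h⟩ := hρ.exists_isotropyGroup_add_le p
  refine ⟨ε, hε, fun v hv hvε => ?_⟩
  have hle := h v hv hvε
  have h1 := hρ.finrank_tangentSpace_add p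
  have h2 := hρ.finrank_tangentSpace_add (p + v)
  have hp := hρ.restrict_isotropyGroup p
  have h3 := finrank_map_add_finrank_inf_ker (ContinuousLinearMap.apply ℝ V v).toLinearMap
    (ρ.restrictSubgroup (ρ.isotropyGroup p)).lieAlgebra
  rw [← hp.tangentSpace_eq] at h3
  have h4 : (ρ.restrictSubgroup (ρ.isotropyGroup p)).lieAlgebra ⊓
      LinearMap.ker (ContinuousLinearMap.apply ℝ V v).toLinearMap =
      (ρ.restrictSubgroup (ρ.isotropyGroup (p + v))).lieAlgebra := by
    ext A
    rw [Submodule.mem_inf, hρ.mem_lieAlgebra_restrict, hρ.mem_lieAlgebra_restrict]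
    constructor
    · rintro ⟨⟨hA, hAp⟩, hAv⟩
      exact ⟨hA, by rw [map_add, hAp]; simpa using hAv⟩
    · rintro ⟨hA, hApv⟩
      have hAp : A p = 0 := apply_eq_zero_of_exp_smul fun t => by
        obtain ⟨g, hg⟩ := hρ.exists_exp_eq hA t
        have hmem : g ∈ ρ.isotropyGroup (p + v) := by
          rw [mem_isotropyGroup, ← toCLM_apply, hg, exp_smul_apply_eq_self hApv]
        rw [← hg]
        exact hle hmem
      refine ⟨⟨hA, hAp⟩, ?_⟩
      rw [map_add, hAp, zero_add] at hApv
      exact hApv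
  rw [h4] at h3
  omega

omit hρ [FiniteDimensional ℝ V] in
theorem exists_smul_norm_lt (v : V) {ε : ℝ} (hε : 0 < ε) :
    ∃ t ∈ Set.Ioo (0 : ℝ) 1, ‖t • v‖ < ε := by
  have h1 : Tendsto (fun t : ℝ => ‖t • v‖) (𝓝[>] 0) (𝓝 0) := by
    have : Continuous fun t : ℝ => ‖t • v‖ := by fun_prop
    simpa using (this.tendsto 0).mono_left nhdsWithin_le_nhds
  obtain ⟨t, ht, ht'⟩ := ((h1.eventually_lt_const hε).and
    (Ioo_mem_nhdsGT (zero_lt_one (α := ℝ)))).exists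
  exact ⟨t, ht', ht⟩

/-- Scaling v does not change the tangent space of its orbit under G_p, so v may be taken small
enough for the slice formula. -/
theorem orbitSpaceDim_add_le {p v : V} (hv : v ∈ ρ.normalSpace p) :
    ρ.orbitSpaceDim +
      Module.finrank ℝ ((ρ.restrictSubgroup (ρ.isotropyGroup p)).tangentSpace v) ≤
      Module.finrank ℝ (ρ.normalSpace p) := by
  obtain ⟨ε, hε, h⟩ := hρ.exists_finrank_tangentSpace_add_eq p
  obtain ⟨t, ht, htv⟩ := exists_smul_norm_lt v hε
  have h1 := h (t • v) (Submodule.smul_mem _ _ hv) htv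
  rw [(hρ.restrict_isotropyGroup p).tangentSpace_smul v ht.1.ne'] at h1
  have h2 := ρ.orbitSpaceDim_le (p + t • v)
  have h3 := ρ.finrank_tangentSpace_add_finrank_normalSpace (p + t • v)
  have h4 := ρ.finrank_tangentSpace_add_finrank_normalSpace p
  omega

/-- The dimension of the orbit space is the cohomogeneity of the slice representation. -/
theorem exists_orbitSpaceDim_add_eq (p : V) :
    ∃ v ∈ ρ.normalSpace p, ρ.orbitSpaceDim +
      Module.finrank ℝ ((ρ.restrictSubgroup (ρ.isotropyGroup p)).tangentSpace v) =
      Module.finrank ℝ (ρ.normalSpace p) := by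
  obtain ⟨q, hq⟩ := ρ.exists_orbitSpaceDim_eq
  obtain ⟨g, hmin, hv⟩ := hρ.exists_closest p q
  refine ⟨_, hv, le_antisymm (hρ.orbitSpaceDim_add_le hv) ?_⟩
  obtain ⟨ε, hε, h⟩ := hρ.exists_finrank_tangentSpace_add_eq p
  obtain ⟨t, ht, htv⟩ := exists_smul_norm_lt (ρ g q - p) hε
  have h1 := h _ (Submodule.smul_mem _ _ hv) htv
  rw [(hρ.restrict_isotropyGroup p).tangentSpace_smul _ ht.1.ne'] at h1
  have hmin' : ∀ h : G, ‖ρ g q - p‖ ≤ ‖ρ h (ρ g q) - p‖ := fun h => by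
    have := hmin (h * g)
    rwa [map_mul, Module.End.mul_apply] at this
  -- A point near p on the shortest segment has isotropy no larger than that of `ρ g q`, hence an
  -- orbit at least as large as the orbit of q, which has maximal dimension.
  have h2 := hρ.finrank_tangentSpace_le_of_isotropyGroup_le
    (hρ.isotropyGroup_segment_le hmin' ht)
  rw [finrank_tangentSpace_apply] at h2
  have h3 := ρ.finrank_tangentSpace_add_finrank_normalSpace q
  have h4 := ρ.finrank_tangentSpace_add_finrank_normalSpace p
  omega

omit hρ [FiniteDimensional ℝ V] in
theorem isotropyGroup_add_eq {p v : V} (hv : v ∈ ρ.fixedNormalSpace p)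
    (hle : ρ.isotropyGroup (p + v) ≤ ρ.isotropyGroup p) :
    ρ.isotropyGroup (p + v) = ρ.isotropyGroup p := by
  refine le_antisymm hle fun g hg => ?_
  have h1 := hv.2 g hg
  rw [mem_isotropyGroup] at hg ⊢
  rw [map_add, hg, h1]

theorem fixedNormalSpace_le_span_velocities (p : V) :
    ρ.fixedNormalSpace p ≤ Submodule.span ℝ (velocities (ρ.isotropyStratum p) p) := by
  intro v hv
  obtain ⟨ε, hε, h⟩ := hρ.exists_isotropyGroup_add_le p
  -- The curve must stay in the stratum for all times, so the line p + t v is replaced by a bounded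
  -- oscillation with velocity v at 0. This c keeps the amplitude ‖v‖ / c below ε.
  set c : ℝ := (‖v‖ + 1) / ε with hc
  have hc0 : 0 < c := by positivity
  refine Submodule.subset_span ⟨fun t => p + (Real.sin (c * t) / c) • v, ?_, by simp, fun t => ?_,
    ?_⟩
  · exact contDiff_const.add (((Real.contDiff_sin.comp (contDiff_const.mul contDiff_id)).div_const
      c).smul contDiff_const)
  · rw [mem_isotropyStratum_iff]
    refine ⟨1, ?_⟩
    rw [map_one, Module.End.one_apply]
    have hmem := Submodule.smul_mem _ (Real.sin (c * t) / c) hv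
    refine isotropyGroup_add_eq hmem (h _ hmem.1 ?_)
    rw [norm_smul, norm_div, Real.norm_of_nonneg hc0.le]
    calc ‖Real.sin (c * t)‖ / c * ‖v‖ ≤ 1 / c * ‖v‖ := by
          gcongr; exact Real.abs_sin_le_one _
      _ = ε * (‖v‖ / (‖v‖ + 1)) := by rw [hc]; field_simp
      _ < ε * 1 := by
          gcongr
          rw [div_lt_one (by positivity)]
          linarith
      _ = ε := mul_one _
  · have h1 : HasDerivAt (fun t : ℝ => Real.sin (c * t) / c) 1 0 := by
      have := (((hasDerivAt_id (0 : ℝ)).const_mul c).sin).div_const c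
      simpa [hc0.ne'] using this
    have h2 := (h1.smul_const v).const_add p
    simpa using h2.deriv

/-- Each point of the curve near p is moved by the group to the closest point p + v of its orbit.
Being in the stratum forces v into the fixed normal space. The displacement splits into orbit motion
of p and a rotated v; rescaled limits are a tangent vector and a fixed normal vector. -/
theorem velocities_isotropyStratum_subset (p : V) :
    velocities (ρ.isotropyStratum p) p ⊆
      (ρ.tangentSpace p ⊔ ρ.fixedNormalSpace p : Submodule ℝ V) := by
  rintro _ ⟨γ, hγ, rfl, hS, rfl⟩
  set p := γ 0 with hp
  obtain ⟨ε, hε, hslice⟩ := hρ.exists_isotropyGroup_add_le p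
  set τ : ℕ → ℝ := fun n => ((n : ℝ) + 1)⁻¹ with hτ
  have hτ0 : Tendsto τ atTop (𝓝 0) := by
    simpa using tendsto_one_div_add_atTop_nhds_zero_nat (𝕜 := ℝ)
  have hd : HasDerivAt γ (deriv γ 0) 0 :=
    (hγ.differentiable (by simp)).differentiableAt.hasDerivAt
  have hγlim : Tendsto (fun n => γ (τ n)) atTop (𝓝 p) := (hγ.continuous.tendsto 0).comp hτ0
  have hdlim : Tendsto (fun n : ℕ => ((n : ℝ) + 1) • (γ (τ n) - p)) atTop (𝓝 (deriv γ 0)) := by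
    have h0 : Tendsto τ atTop (𝓝[≠] 0) :=
      tendsto_nhdsWithin_iff.2 ⟨hτ0, Eventually.of_forall fun n => by
        simp only [hτ, Set.mem_compl_iff, Set.mem_singleton_iff]; positivity⟩
    simpa [Function.comp_def, hτ] using hd.tendsto_slope_zero.comp h0
  choose g hmin hnormal using fun n => hρ.exists_closest p (γ (τ n))
  set v : ℕ → V := fun n => ρ (g n) (γ (τ n)) - p with hv
  have hvle : ∀ n, ‖v n‖ ≤ ‖γ (τ n) - p‖ := fun n => by simpa using hmin n 1
  have hsub0 : Tendsto (fun n => ‖γ (τ n) - p‖) atTop (𝓝 0) :=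
    tendsto_iff_norm_sub_tendsto_zero.1 hγlim
  have hv0 : Tendsto (fun n => ‖v n‖) atTop (𝓝 0) :=
    squeeze_zero (fun n => norm_nonneg _) hvle hsub0
  have hvfix : ∀ᶠ n in atTop, v n ∈ ρ.fixedNormalSpace p := by
    filter_upwards [hv0.eventually_lt_const hε] with n hn
    have hle := hslice _ (hnormal n) hn
    refine ⟨hnormal n, ?_⟩
    obtain ⟨k, hk⟩ := ρ.mem_isotropyStratum_iff.1 (hS (τ n))
    have hpv : p + v n = ρ (g n) (γ (τ n)) := by simp [hv]
    have h1 : ρ.isotropyGroup (p + v n) = ρ.isotropyGroup (ρ (g n * k) p) := by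
      rw [hpv, isotropyGroup_apply, hk, ← isotropyGroup_apply, map_mul, Module.End.mul_apply]
    -- The slice property gives one inclusion; a conjugate of G_p inside G_p is G_p.
    have h2 : ρ.isotropyGroup (p + v n) = ρ.isotropyGroup p := by
      rw [h1] at hle ⊢
      exact ρ.isotropyGroup_apply_eq_of_le hle
    have h3 := Submodule.sub_mem _ (ρ.self_mem_fixedSpace (p + v n))
      (h2 ▸ ρ.self_mem_fixedSpace p)
    rwa [add_sub_cancel_left, h2] at h3
  have hdecomp : ∀ n, γ (τ n) - p = (ρ (g n)⁻¹ p - p) + ρ (g n)⁻¹ (v n) := by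
    intro n
    rw [hv]
    simp only [map_sub, inv_apply_apply]
    abel
  have hgp : Tendsto (fun n => ρ (g n)⁻¹ p) atTop (𝓝 p) := by
    rw [tendsto_iff_norm_sub_tendsto_zero]
    refine squeeze_zero (fun n => norm_nonneg _) (fun n => ?_)
      (g := fun n => ‖γ (τ n) - p‖ + ‖v n‖) (by simpa using hsub0.add hv0)
    rw [eq_sub_iff_add_eq.2 (hdecomp n).symm]
    exact (norm_sub_le _ _).trans (by rw [hρ.norm_map])
  obtain ⟨C, hC⟩ := hdlim.norm.bddAbove_range
  obtain ⟨⟨k, w⟩, ⟨⟨h, rfl⟩, -⟩, φ, hφ, hlim⟩ :=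
    (hρ.isCompact_range.prod (isCompact_closedBall (0 : V) C)).tendsto_subseq
    (x := fun n => (ρ.toCLM (g n)⁻¹, ((n : ℝ) + 1) • v n)) fun n => by
      refine ⟨⟨_, rfl⟩, mem_closedBall_zero_iff.2 ?_⟩
      refine le_trans ?_ (hC ⟨n, rfl⟩)
      simp only [norm_smul]
      gcongr
      exact hvle n
  have hk := hlim.fst_nhds
  have hw := hlim.snd_nhds
  simp only [Function.comp_def] at hk hw
  have hwmem : w ∈ ρ.fixedNormalSpace p := by
    refine (Submodule.closed_of_finiteDimensional (ρ.fixedNormalSpace p)).mem_of_tendsto hw ?_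
    filter_upwards [hφ.tendsto_atTop.eventually hvfix] with n hn
    exact Submodule.smul_mem _ _ hn
  have happ : ∀ {u : ℕ → V} {u₀ : V}, Tendsto u atTop (𝓝 u₀) →
      Tendsto (fun n => ρ (g (φ n))⁻¹ (u n)) atTop (𝓝 (ρ h u₀)) := fun {u u₀} hu =>
    ((isBoundedBilinearMap_apply (𝕜 := ℝ) (E := V) (F := V)).continuous.tendsto
      (ρ.toCLM h, u₀)).comp (hk.prodMk_nhds hu)
  have hhp : ρ h p = p := tendsto_nhds_unique (happ tendsto_const_nhds)
    (hgp.comp hφ.tendsto_atTop)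
  -- The limit h of the moving elements fixes p, so it fixes w as well, and no rotation remains in
  -- the limit.
  have hhw : ρ h w = w := hwmem.2 h hhp
  have hlimT : Tendsto (fun n => ((φ n : ℝ) + 1) • (ρ (g (φ n))⁻¹ p - p)) atTop
      (𝓝 (deriv γ 0 - w)) := by
    have h1 := (hdlim.comp hφ.tendsto_atTop).sub (happ hw)
    rw [hhw] at h1
    refine h1.congr fun n => ?_
    simp only [Function.comp_apply]
    rw [hdecomp, map_smul]
    module
  obtain ⟨A, hA, hAp⟩ := hρ.mem_map_lieAlgebra_of_tendsto (hgp.comp hφ.tendsto_atTop) hlimT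
  refine Submodule.mem_sup.2 ⟨deriv γ 0 - w, hρ.mem_tangentSpace.2 ⟨A, hA, hAp⟩, w, hwmem, ?_⟩
  abel

theorem span_velocities_isotropyStratum (p : V) :
    Submodule.span ℝ (velocities (ρ.isotropyStratum p) p) =
      ρ.tangentSpace p ⊔ ρ.fixedNormalSpace p := by
  refine le_antisymm (Submodule.span_le.2 (hρ.velocities_isotropyStratum_subset p))
    (sup_le (Submodule.span_mono ?_) (hρ.fixedNormalSpace_le_span_velocities p))
  rintro _ ⟨γ, hγ, h0, hS, rfl⟩
  refine ⟨γ, hγ, h0, fun t => ?_, rfl⟩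
  obtain ⟨g, hg⟩ := hS t
  exact ρ.mem_isotropyStratum_iff.2 ⟨g, by rw [← hg]⟩

theorem orbitSpaceStratumDim_eq (p : V) :
    ρ.orbitSpaceStratumDim p = Module.finrank ℝ (ρ.fixedNormalSpace p) := by
  have hdisj : Disjoint (ρ.tangentSpace p) (ρ.fixedNormalSpace p) :=
    (Submodule.orthogonal_disjoint (ρ.tangentSpace p)).mono_right inf_le_left
  have h1 : dimAt (ρ.isotropyStratum p) p = Module.finrank ℝ (ρ.tangentSpace p) +
      Module.finrank ℝ (ρ.fixedNormalSpace p) := by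
    rw [dimAt, hρ.span_velocities_isotropyStratum, ← Submodule.finrank_sup_add_finrank_inf_eq,
      hdisj.eq_bot, finrank_bot, add_zero]
  have h2 : dimAt (ρ.orbitSet p) p = Module.finrank ℝ (ρ.tangentSpace p) := rfl
  rw [orbitSpaceStratumDim, h1, h2, Nat.add_sub_cancel_left]

theorem hasCodimOneStratum_iff (p : V) :
    ρ.HasCodimOneStratum p ↔ ρ.orbitSpaceDim = Module.finrank ℝ (ρ.fixedNormalSpace p) + 1 := by
  rw [HasCodimOneStratum, hρ.orbitSpaceStratumDim_eq]

end IsCompactOrthogonal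

end Representation

/-! ### Principal isotropy and strata of codimension one. -/

namespace Representation

variable {G V : Type*} [Group G] [NormedAddCommGroup V] [InnerProductSpace ℝ V]
  [FiniteDimensional ℝ V]

/-- The elements of the Lie algebra whose class modulo the Lie algebra of `H` is fixed by `H`. -/
def fixedModuloLieAlgebra (ρ : Representation ℝ G V) (H : Subgroup G) :
    Submodule ℝ (V →L[ℝ] V) :=
  ρ.lieAlgebra ⊓ ⨅ h : H, (ρ.restrictSubgroup H).lieAlgebra.comap
    (LinearMap.mulLeft ℝ (ρ.toCLM (h : G)) ∘ₗ LinearMap.mulRight ℝ (ρ.toCLM (h : G)⁻¹) -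
      LinearMap.id)

theorem mem_fixedModuloLieAlgebra {ρ : Representation ℝ G V} {H : Subgroup G} {A : V →L[ℝ] V} :
    A ∈ ρ.fixedModuloLieAlgebra H ↔ A ∈ ρ.lieAlgebra ∧
      ∀ h ∈ H, ρ.toCLM h * A * ρ.toCLM h⁻¹ - A ∈ (ρ.restrictSubgroup H).lieAlgebra := by
  simp [fixedModuloLieAlgebra, mul_assoc]

namespace IsCompactOrthogonal

variable {ρ : Representation ℝ G V} (hρ : ρ.IsCompactOrthogonal)
include hρ

/-- The point of the orbit of q closest to p is p plus a normal vector, and both summands are fixed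
by G_p. -/
theorem exists_isotropyGroup_le_apply {p : V}
    (hp : ρ.normalSpace p ≤ ρ.fixedSpace (ρ.isotropyGroup p)) (q : V) :
    ∃ g, ρ.isotropyGroup p ≤ ρ.isotropyGroup (ρ g q) := by
  obtain ⟨g, -, hg⟩ := hρ.exists_closest p q
  refine ⟨g, mem_fixedSpace_iff_le.1 ?_⟩
  have := Submodule.add_mem _ (hp hg) (ρ.self_mem_fixedSpace p)
  rwa [sub_add_cancel] at this

/-- The isotropy group of `p` is principal if and only if its slice representation is trivial. -/
theorem isPrincipalIsotropyGroup_iff (p : V) :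
    ρ.IsPrincipalIsotropyGroup (ρ.isotropyGroup p) ↔
      ρ.normalSpace p ≤ ρ.fixedSpace (ρ.isotropyGroup p) := by
  constructor
  · intro hmin v hv
    obtain ⟨ε, hε, h⟩ := hρ.exists_isotropyGroup_add_le p
    obtain ⟨t, ht, htv⟩ := exists_smul_norm_lt v hε
    have hle := hmin.2 ⟨p + t • v, rfl⟩ (h _ (Submodule.smul_mem _ _ hv) htv)
    have h1 := Submodule.sub_mem _ (mem_fixedSpace_iff_le.2 hle) (ρ.self_mem_fixedSpace p)
    rw [add_sub_cancel_left] at h1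
    exact (Submodule.smul_mem_iff _ ht.1.ne').1 h1
  · intro hp
    refine ⟨⟨p, rfl⟩, ?_⟩
    rintro _ ⟨q, rfl⟩ hle
    obtain ⟨g, hg⟩ := hρ.exists_isotropyGroup_le_apply hp q
    rw [ρ.isotropyGroup_eq_apply_of_le (hle.trans hg)]
    exact hg

theorem exists_isotropyGroup_apply_eq {p : V}
    (hp : ρ.normalSpace p ≤ ρ.fixedSpace (ρ.isotropyGroup p)) {H : Subgroup G}
    (hH : ρ.IsPrincipalIsotropyGroup H) : ∃ g, ρ.isotropyGroup (ρ g p) = H := by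
  obtain ⟨q, rfl⟩ := hH.1
  obtain ⟨g, hg⟩ := hρ.exists_isotropyGroup_le_apply hp q
  have hle : ρ.isotropyGroup (ρ g⁻¹ p) ≤ ρ.isotropyGroup q := by
    rw [isotropyGroup_apply, ← inv_apply_apply ρ g q, ρ.isotropyGroup_apply g⁻¹ (ρ g q)]
    exact Subgroup.map_mono hg
  exact ⟨g⁻¹, le_antisymm hle (hH.2 ⟨_, rfl⟩ hle)⟩

/-- Together with `fixedModuloLieAlgebra_inf_ker`, this computes the dimension of the fixed tangent
vectors from data that depend only on the group G_p and not on p. -/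
theorem map_fixedModuloLieAlgebra (p : V) :
    (ρ.fixedModuloLieAlgebra (ρ.isotropyGroup p)).map
      (ContinuousLinearMap.apply ℝ V p).toLinearMap =
      ρ.tangentSpace p ⊓ ρ.fixedSpace (ρ.isotropyGroup p) := by
  have key : ∀ (A : V →L[ℝ] V), ∀ h ∈ ρ.isotropyGroup p,
      (ρ.toCLM h * A * ρ.toCLM h⁻¹ - A) p = ρ h (A p) - A p := by
    intro A h hh
    have : ρ h⁻¹ p = p := (ρ.isotropyGroup p).inv_mem hh
    simp [this]
  ext v
  constructor
  · rintro ⟨A, hA, rfl⟩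
    obtain ⟨hA, hAh⟩ := mem_fixedModuloLieAlgebra.1 hA
    refine ⟨hρ.mem_tangentSpace.2 ⟨A, hA, rfl⟩, fun h hh => ?_⟩
    have h1 := (hρ.mem_lieAlgebra_restrict.1 (hAh h hh)).2
    rw [key A h hh] at h1
    exact sub_eq_zero.1 h1
  · rintro ⟨hv, hfix⟩
    obtain ⟨A, hA, rfl⟩ := hρ.mem_tangentSpace.1 hv
    refine ⟨A, mem_fixedModuloLieAlgebra.2 ⟨hA, fun h hh => ?_⟩, rfl⟩
    refine hρ.mem_lieAlgebra_restrict.2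
      ⟨Submodule.sub_mem _ (hρ.conj_mem_lieAlgebra hA h) hA, ?_⟩
    rw [key A h hh, hfix h hh, sub_self]

theorem fixedModuloLieAlgebra_inf_ker (p : V) :
    ρ.fixedModuloLieAlgebra (ρ.isotropyGroup p) ⊓
      LinearMap.ker (ContinuousLinearMap.apply ℝ V p).toLinearMap =
      (ρ.restrictSubgroup (ρ.isotropyGroup p)).lieAlgebra := by
  ext A
  rw [Submodule.mem_inf, mem_fixedModuloLieAlgebra, hρ.mem_lieAlgebra_restrict]
  constructor
  · rintro ⟨⟨hA, -⟩, hAp⟩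
    exact ⟨hA, hAp⟩
  · rintro ⟨hA, hAp⟩
    refine ⟨⟨hA, fun h hh => hρ.mem_lieAlgebra_restrict.2
      ⟨Submodule.sub_mem _ (hρ.conj_mem_lieAlgebra hA h) hA, ?_⟩⟩, hAp⟩
    have : ρ h⁻¹ p = p := (ρ.isotropyGroup p).inv_mem hh
    simp [this, hAp]

/-- G_p preserves the tangent and normal spaces, so both components of a fixed vector are fixed. -/
theorem finrank_fixedSpace (p : V) :
    Module.finrank ℝ (ρ.tangentSpace p ⊓ ρ.fixedSpace (ρ.isotropyGroup p) : Submodule ℝ V) +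
      Module.finrank ℝ (ρ.fixedNormalSpace p) =
      Module.finrank ℝ (ρ.fixedSpace (ρ.isotropyGroup p)) := by
  suffices h : ρ.fixedNormalSpace p =
      (ρ.tangentSpace p ⊓ ρ.fixedSpace (ρ.isotropyGroup p))ᗮ ⊓
        ρ.fixedSpace (ρ.isotropyGroup p) by
    rw [h]
    exact Submodule.finrank_add_inf_finrank_orthogonal inf_le_right
  apply le_antisymm
  · exact inf_le_inf_right _ (Submodule.orthogonal_le inf_le_left)
  · rintro v ⟨hv, hfix⟩
    refine ⟨?_, hfix⟩
    obtain ⟨w, hw, u, hu, rfl⟩ := (ρ.tangentSpace p).exists_add_mem_mem_orthogonal v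
    have hwfix : w ∈ ρ.fixedSpace (ρ.isotropyGroup p) := by
      intro h hh
      have h1 := hρ.map_mem_tangentSpace h hw
      have h2 := hρ.map_mem_normalSpace h hu
      rw [hh] at h1 h2
      have h3 := hfix h hh
      rw [map_add] at h3
      have h4 : ρ h w - w = u - ρ h u := by
        rw [sub_eq_sub_iff_add_eq_add, h3, add_comm]
      have h5 := Submodule.sub_mem _ h1 hw
      have h6 := Submodule.sub_mem _ hu h2
      rw [← h4] at h6
      exact sub_eq_zero.1 (Submodule.disjoint_def.1
        (Submodule.orthogonal_disjoint (ρ.tangentSpace p)) _ h5 h6)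
    have h1 := (Submodule.mem_orthogonal _ _).1 hv w ⟨hw, hwfix⟩
    rw [inner_add_right, (Submodule.mem_orthogonal _ _).1 hu w hw, add_zero,
      inner_self_eq_zero] at h1
    rw [h1, zero_add]
    exact hu

/-- The dimension of the stratum through `p` depends only on the isotropy group of `p`. -/
theorem finrank_fixedNormalSpace_eq {p q : V} (h : ρ.isotropyGroup p = ρ.isotropyGroup q) :
    Module.finrank ℝ (ρ.fixedNormalSpace p) = Module.finrank ℝ (ρ.fixedNormalSpace q) := by
  have h1 := hρ.finrank_fixedSpace p
  have h2 := hρ.finrank_fixedSpace q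
  have h3 := finrank_map_add_finrank_inf_ker (ContinuousLinearMap.apply ℝ V p).toLinearMap
    (ρ.fixedModuloLieAlgebra (ρ.isotropyGroup p))
  have h4 := finrank_map_add_finrank_inf_ker (ContinuousLinearMap.apply ℝ V q).toLinearMap
    (ρ.fixedModuloLieAlgebra (ρ.isotropyGroup q))
  rw [hρ.map_fixedModuloLieAlgebra, hρ.fixedModuloLieAlgebra_inf_ker] at h3 h4
  rw [h] at h1 h3
  omega

theorem hasCodimOneStratum_iff_of_isotropyGroup_eq {p q : V}
    (h : ρ.isotropyGroup p = ρ.isotropyGroup q) :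
    ρ.HasCodimOneStratum p ↔ ρ.HasCodimOneStratum q := by
  rw [hρ.hasCodimOneStratum_iff, hρ.hasCodimOneStratum_iff, hρ.finrank_fixedNormalSpace_eq h]

/-- The curve exp(tA) u stays in N; differentiate its pairing with the orthogonal complement. -/
theorem lieAlgebra_apply_mem {N : Submodule ℝ V} (hN : ∀ g, ∀ u ∈ N, ρ g u ∈ N)
    {A : V →L[ℝ] V} (hA : A ∈ ρ.lieAlgebra) {u : V} (hu : u ∈ N) : A u ∈ N := by
  rw [← N.orthogonal_orthogonal, Submodule.mem_orthogonal']
  intro w hw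
  have h1 := (hasDerivAt_exp_smul_apply_zero A u).inner ℝ (hasDerivAt_const (0 : ℝ) w)
  have h2 : (fun t : ℝ => inner ℝ (NormedSpace.exp (t • A) u) w) = fun _ => 0 := by
    funext t
    obtain ⟨g, hg⟩ := hρ.exists_exp_eq hA t
    rw [← hg]
    exact (Submodule.mem_orthogonal _ _).1 hw _ (hN g u hu)
  rw [h2] at h1
  simpa using h1.unique (hasDerivAt_const _ _)

/-- The component of v in N works, by skewness and invariance of N. If it vanishes, the whole orbit
tangent at v is orthogonal to N and any nonzero vector of N works. -/
theorem exists_mem_orthogonal_tangentSpace {N : Submodule ℝ V} (hN : ∀ g, ∀ u ∈ N, ρ g u ∈ N)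
    (hne : N ≠ ⊥) (v : V) : ∃ u ∈ N, u ≠ 0 ∧ u ∈ ρ.normalSpace v := by
  obtain ⟨a, ha, b, hb, rfl⟩ := N.exists_add_mem_mem_orthogonal v
  have hb' : ∀ A ∈ ρ.lieAlgebra, ∀ u ∈ N, inner ℝ (A b) u = 0 := fun A hA u hu => by
    rw [hρ.inner_lieAlgebra hA, (Submodule.mem_orthogonal' _ _).1 hb _
      (hρ.lieAlgebra_apply_mem hN hA hu), neg_zero]
  by_cases h0 : a = 0
  · obtain ⟨u, hu, hu0⟩ := Submodule.exists_mem_ne_zero_of_ne_bot hne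
    refine ⟨u, hu, hu0, hρ.mem_normalSpace.2 fun A hA => ?_⟩
    rw [h0, zero_add, hb' A hA u hu]
  · refine ⟨a, ha, h0, hρ.mem_normalSpace.2 fun A hA => ?_⟩
    rw [map_add, inner_add_left, hρ.inner_lieAlgebra_self hA, hb' A hA a ha, add_zero]

theorem fixedNormalSpace_le_normalSpace_restrict (p v : V) :
    ρ.fixedNormalSpace p ≤ (ρ.restrictSubgroup (ρ.isotropyGroup p)).normalSpace v := by
  intro f hf
  have hσ := hρ.restrict_isotropyGroup p
  refine hσ.mem_normalSpace.2 fun A hA => ?_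
  have hAf : A f = 0 := apply_eq_zero_of_exp_smul fun t => by
    obtain ⟨g, hg⟩ := hσ.exists_exp_eq hA t
    rw [← hg]
    exact hf.2 g g.2
  rw [hσ.inner_lieAlgebra hA, hAf, inner_zero_right, neg_zero]

/-- If h moves a in N, then h a - a is a nonzero vector of N orthogonal to all fixed vectors. So the
part of N orthogonal to `fixedNormalSpace` is a nonzero invariant subspace, and
`exists_mem_orthogonal_tangentSpace` applies to it. -/
theorem exists_normal_of_not_le_fixedSpace {p : V} {N : Submodule ℝ V}
    (hN : ∀ g ∈ ρ.isotropyGroup p, ∀ u ∈ N, ρ g u ∈ N)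
    (hfix : ¬ N ≤ ρ.fixedSpace (ρ.isotropyGroup p)) (v : V) :
    ∃ u ∈ N, u ≠ 0 ∧ u ∈ (ρ.fixedNormalSpace p)ᗮ ∧
      u ∈ (ρ.restrictSubgroup (ρ.isotropyGroup p)).normalSpace v := by
  have hinv : ∀ g : ρ.isotropyGroup p, ∀ u ∈ N ⊓ (ρ.fixedNormalSpace p)ᗮ,
      ρ.restrictSubgroup (ρ.isotropyGroup p) g u ∈ N ⊓ (ρ.fixedNormalSpace p)ᗮ := by
    rintro ⟨g, hg⟩ u ⟨hu, hu'⟩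
    refine ⟨hN g hg u hu, (Submodule.mem_orthogonal' _ _).2 fun f hf => ?_⟩
    have h1 : ρ g⁻¹ f = f := hf.2 _ (inv_mem hg)
    rw [restrictSubgroup_apply, hρ.inner_map_left, h1]
    exact (Submodule.mem_orthogonal' _ _).1 hu' f hf
  have hne : N ⊓ (ρ.fixedNormalSpace p)ᗮ ≠ ⊥ := by
    obtain ⟨a, ha, hna⟩ := SetLike.not_le_iff_exists.1 hfix
    rw [mem_fixedSpace] at hna
    push Not at hna
    obtain ⟨h, hh, hne⟩ := hna
    refine (Submodule.ne_bot_iff _).2 ⟨ρ h a - a, ⟨Submodule.sub_mem _ (hN h hh a ha) ha,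
      (Submodule.mem_orthogonal' _ _).2 fun f hf => ?_⟩, sub_ne_zero.2 hne⟩
    have h1 : ρ h⁻¹ f = f := hf.2 _ (inv_mem hh)
    rw [inner_sub_left, hρ.inner_map_left, h1, sub_self]
  obtain ⟨u, hu, hu0, hun⟩ :=
    (hρ.restrict_isotropyGroup p).exists_mem_orthogonal_tangentSpace hinv hne v
  exact ⟨u, hu.1, hu0, hu.2, hun⟩

/-- At a point of a stratum of codimension one, of two orthogonal invariant subspaces of the slice
representation at least one is fixed by the isotropy group. -/
theorem le_fixedSpace_or_le_fixedSpace {p : V} (hp : ρ.HasCodimOneStratum p)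
    {N₁ N₂ : Submodule ℝ V} (h₁ : N₁ ≤ ρ.normalSpace p) (h₂ : N₂ ≤ ρ.normalSpace p)
    (horth : N₁ ⟂ N₂) (hN₁ : ∀ g ∈ ρ.isotropyGroup p, ∀ u ∈ N₁, ρ g u ∈ N₁)
    (hN₂ : ∀ g ∈ ρ.isotropyGroup p, ∀ u ∈ N₂, ρ g u ∈ N₂) :
    N₁ ≤ ρ.fixedSpace (ρ.isotropyGroup p) ∨ N₂ ≤ ρ.fixedSpace (ρ.isotropyGroup p) := by
  by_contra hcon
  push Not at hcon
  rw [hρ.hasCodimOneStratum_iff] at hp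
  obtain ⟨v, hv, hdim⟩ := hρ.exists_orbitSpaceDim_add_eq p
  obtain ⟨u₁, hu₁, hu₁0, hu₁F, hu₁n⟩ := hρ.exists_normal_of_not_le_fixedSpace hN₁ hcon.1 v
  obtain ⟨u₂, hu₂, hu₂0, hu₂F, hu₂n⟩ := hρ.exists_normal_of_not_le_fixedSpace hN₂ hcon.2 v
  have hσ := hρ.restrict_isotropyGroup p
  set M := (ρ.restrictSubgroup (ρ.isotropyGroup p)).tangentSpace v with hM
  have hMle : M ≤ ρ.normalSpace p := by
    intro w hw
    obtain ⟨A, hA, rfl⟩ := hσ.mem_tangentSpace.1 hw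
    refine hσ.lieAlgebra_apply_mem (fun g u hu => ?_) hA hv
    have h1 := hρ.map_mem_normalSpace (g : G) hu
    rwa [show ρ (g : G) p = p from g.2] at h1
  have h1 := Submodule.finrank_add_inf_finrank_orthogonal hMle
  have hd₁ : ρ.fixedNormalSpace p ⟂ Submodule.span ℝ {u₁} := by
    rw [Submodule.isOrtho_comm, Submodule.isOrtho_iff_le, Submodule.span_singleton_le_iff_mem]
    exact hu₁F
  have hd₂ : ρ.fixedNormalSpace p ⊔ Submodule.span ℝ {u₁} ⟂ Submodule.span ℝ {u₂} := by
    rw [Submodule.isOrtho_sup_left]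
    constructor
    · rw [Submodule.isOrtho_comm, Submodule.isOrtho_iff_le, Submodule.span_singleton_le_iff_mem]
      exact hu₂F
    · exact horth.mono ((Submodule.span_singleton_le_iff_mem _ _).2 hu₁)
        ((Submodule.span_singleton_le_iff_mem _ _).2 hu₂)
  have h2 := Submodule.finrank_sup_add_finrank_inf_eq (ρ.fixedNormalSpace p)
    (Submodule.span ℝ {u₁})
  have h3 := Submodule.finrank_sup_add_finrank_inf_eq
    (ρ.fixedNormalSpace p ⊔ Submodule.span ℝ {u₁}) (Submodule.span ℝ {u₂})
  rw [hd₁.disjoint.eq_bot, finrank_bot, finrank_span_singleton hu₁0] at h2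
  rw [hd₂.disjoint.eq_bot, finrank_bot, finrank_span_singleton hu₂0] at h3
  -- With dim F the stratum dimension, the complement of M in the normal space has dimension dim X =
  -- dim F + 1, by the choice of v. It would contain F and two further independent directions.
  have hle : ρ.fixedNormalSpace p ⊔ Submodule.span ℝ {u₁} ⊔ Submodule.span ℝ {u₂} ≤
      Mᗮ ⊓ ρ.normalSpace p := by
    refine sup_le (sup_le (le_inf (hρ.fixedNormalSpace_le_normalSpace_restrict p v) inf_le_left)
      ?_) ?_
    · exact (Submodule.span_singleton_le_iff_mem _ _).2 ⟨hu₁n, h₁ hu₁⟩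
    · exact (Submodule.span_singleton_le_iff_mem _ _).2 ⟨hu₂n, h₂ hu₂⟩
  have h4 := Submodule.finrank_mono hle
  omega

end IsCompactOrthogonal

end Representation

/-! ### Equivariant maps and orthogonal sums. -/

namespace Representation

section Equivariant

variable {G U W : Type*} [Group G] [NormedAddCommGroup U] [InnerProductSpace ℝ U]
  [FiniteDimensional ℝ U] [NormedAddCommGroup W] [InnerProductSpace ℝ W] [FiniteDimensional ℝ W]
  {σ : Representation ℝ G U} {π : Representation ℝ G W}

omit [FiniteDimensional ℝ U] [FiniteDimensional ℝ W] in
theorem orbitSet_of_equivariant {ι : U →ₗ[ℝ] W} (hι : ∀ g u, ι (σ g u) = π g (ι u)) (u : U) :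
    π.orbitSet (ι u) = ι '' σ.orbitSet u := by
  ext w
  constructor
  · rintro ⟨g, rfl⟩
    exact ⟨_, ⟨g, rfl⟩, hι g u⟩
  · rintro ⟨_, ⟨g, rfl⟩, rfl⟩
    exact ⟨g, (hι g u).symm⟩

omit [FiniteDimensional ℝ U] [FiniteDimensional ℝ W] in
theorem isotropyGroup_of_equivariant {ι : U →ₗ[ℝ] W} (hinj : Function.Injective ι)
    (hι : ∀ g u, ι (σ g u) = π g (ι u)) (u : U) :
    π.isotropyGroup (ι u) = σ.isotropyGroup u := by
  ext g
  rw [mem_isotropyGroup, mem_isotropyGroup, ← hι, hinj.eq_iff]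

theorem tangentSpace_of_equivariant {ι : U →ₗ[ℝ] W} (hinj : Function.Injective ι)
    (hι : ∀ g u, ι (σ g u) = π g (ι u)) (u : U) :
    π.tangentSpace (ι u) = (σ.tangentSpace u).map ι := by
  rw [tangentSpace, orbitSet_of_equivariant hι, span_velocities_image _ hinj]; rfl

/-- The notion involves only dimensions and isotropy groups, so an equivariant linear equivalence
suffices and need not be isometric. -/
theorem hasCodimOneStratum_of_equivariant (e : U ≃ₗ[ℝ] W) (he : ∀ g u, e (σ g u) = π g (e u))
    (u : U) : π.HasCodimOneStratum (e u) ↔ σ.HasCodimOneStratum u := by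
  have hinj : Function.Injective e.toLinearMap := e.injective
  have horb : ∀ u, dimAt (π.orbitSet (e u)) (e u) = dimAt (σ.orbitSet u) u := fun u => by
    have h1 := orbitSet_of_equivariant (ι := e.toLinearMap) he u
    have h2 := dimAt_image e.toLinearMap hinj (σ.orbitSet u) u
    rw [← h1] at h2
    exact h2
  have hiso : ∀ u, π.isotropyGroup (e u) = σ.isotropyGroup u := fun u =>
    isotropyGroup_of_equivariant (ι := e.toLinearMap) hinj he u
  have hstr : π.isotropyStratum (e u) = e.toLinearMap '' σ.isotropyStratum u := by
    ext w
    obtain ⟨v, rfl⟩ := e.surjective w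
    simp only [isotropyStratum, Set.mem_ofPred_eq, hiso, Set.mem_image, LinearEquiv.coe_coe,
      e.injective.eq_iff, exists_eq_right]
  have hdim : π.orbitSpaceDim = σ.orbitSpaceDim := by
    rw [orbitSpaceDim, orbitSpaceDim]
    exact (e.toEquiv.iInf_congr fun u => by
      rw [e.finrank_eq]
      congr 1
      exact horb u).symm
  have hstrdim : dimAt (π.isotropyStratum (e u)) (e u) = dimAt (σ.isotropyStratum u) u := by
    rw [hstr]
    exact dimAt_image e.toLinearMap hinj _ _
  rw [HasCodimOneStratum, HasCodimOneStratum, hdim, orbitSpaceStratumDim, orbitSpaceStratumDim,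
    hstrdim, horb]

variable {ι : U →ₗᵢ[ℝ] W} (hι : ∀ g u, ι (σ g u) = π g (ι u))
include hι

theorem IsCompactOrthogonal.of_isometry (hπ : π.IsCompactOrthogonal) :
    σ.IsCompactOrthogonal where
  inner_map_map g v w := by
    rw [← ι.inner_map_map, hι, hι, hπ.inner_map_map, ι.inner_map_map]
  isCompact_range := by
    obtain ⟨r, hr⟩ := ι.toLinearMap.exists_leftInverse_of_injective
      (LinearMap.ker_eq_bot.2 ι.injective)
    have hcont : Continuous fun k : W →L[ℝ] W =>
        (LinearMap.toContinuousLinearMap r ∘L k) ∘L ι.toContinuousLinearMap :=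
      ((ContinuousLinearMap.compL ℝ W W U (LinearMap.toContinuousLinearMap r)).continuous).clm_comp
        continuous_const
    convert hπ.isCompact_range.image hcont using 1
    rw [← Set.range_comp]
    congr 1
    funext g
    ext u
    have h1 : r (ι (σ g u)) = σ g u := LinearMap.congr_fun hr _
    simp only [Function.comp_apply, ContinuousLinearMap.comp_apply, toCLM_apply,
      LinearIsometry.coe_toContinuousLinearMap, LinearMap.coe_toContinuousLinearMap']
    rw [← hι, h1]

theorem mem_tangentSpace_isometry {u : U} {w : W} :
    w ∈ π.tangentSpace (ι u) ↔ ∃ t ∈ σ.tangentSpace u, ι t = w := by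
  have h := tangentSpace_of_equivariant (ι := ι.toLinearMap) ι.injective hι u
  rw [LinearIsometry.coe_toLinearMap] at h
  rw [h]
  rfl

theorem finrank_tangentSpace_isometry (u : U) :
    Module.finrank ℝ (π.tangentSpace (ι u)) = Module.finrank ℝ (σ.tangentSpace u) := by
  have h := tangentSpace_of_equivariant (ι := ι.toLinearMap) ι.injective hι u
  rw [LinearIsometry.coe_toLinearMap] at h
  rw [h]
  exact finrank_map_of_injective ι.injective _

theorem mem_normalSpace_isometry {u v : U} :
    v ∈ σ.normalSpace u ↔ ι v ∈ π.normalSpace (ι u) := by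
  simp only [normalSpace, Submodule.mem_orthogonal, mem_tangentSpace_isometry hι]
  constructor
  · rintro h _ ⟨t, ht, rfl⟩
    rw [ι.inner_map_map, h t ht]
  · intro h t ht
    rw [← ι.inner_map_map, h _ ⟨t, ht, rfl⟩]

omit [FiniteDimensional ℝ U] [FiniteDimensional ℝ W] in
theorem restrictSubgroup_equivariant (H : Subgroup G) (h : H) (u : U) :
    ι (σ.restrictSubgroup H h u) = π.restrictSubgroup H h (ι u) := hι h u

/-- Suppose that the normal vectors at `x` are tangent to the stratum through `p`, and that the
fixed space of the isotropy group of `x` cannot grow when `p` moves along its stratum by such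
vectors. Then the isotropy group of `x` acts trivially on the normal space. -/
theorem IsCompactOrthogonal.normalSpace_le_fixedSpace_of_maximal (hπ : π.IsCompactOrthogonal)
    {p : W} (hp : π.HasCodimOneStratum p) {x : U}
    (h₁ : ∀ v ∈ σ.normalSpace x, ι v ∈ π.fixedNormalSpace p)
    (h₂ : ∀ v, π.HasCodimOneStratum (p + ι v) →
      Module.finrank ℝ (σ.fixedSpace (σ.isotropyGroup (x + v))) ≤
        Module.finrank ℝ (σ.fixedSpace (σ.isotropyGroup x))) :
    σ.normalSpace x ≤ σ.fixedSpace (σ.isotropyGroup x) := by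
  intro v hv
  have hσ : σ.IsCompactOrthogonal := .of_isometry hι hπ
  obtain ⟨ε, hε, h⟩ := hσ.exists_isotropyGroup_add_le x
  obtain ⟨ε', hε', h'⟩ := hπ.exists_isotropyGroup_add_le p
  obtain ⟨t, ht, htv⟩ := exists_smul_norm_lt v (lt_min hε hε')
  have hmem := Submodule.smul_mem _ t hv
  have hle := h _ hmem (htv.trans_le (min_le_left _ _))
  have hle' := h' _ (h₁ _ hmem).1
    (by rw [ι.norm_map]; exact htv.trans_le (min_le_right _ _))
  have hcodim := (hπ.hasCodimOneStratum_iff_of_isotropyGroup_eq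
    (isotropyGroup_add_eq (h₁ _ hmem) hle')).2 hp
  -- The smaller isotropy group has the larger fixed space, and the hypothesis on dimensions turns
  -- the inclusion into equality. Hence x + t v, and with it v, is fixed by the isotropy group of x.
  have heq := Submodule.eq_of_le_of_finrank_le (σ.fixedSpace_anti hle) (h₂ _ hcodim)
  have h1 := σ.self_mem_fixedSpace (x + t • v)
  rw [← heq] at h1
  have h2 := Submodule.sub_mem _ h1 (σ.self_mem_fixedSpace x)
  rw [add_sub_cancel_left] at h2
  exact (Submodule.smul_mem_iff _ ht.1.ne').1 h2

end Equivariant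

section Product

variable {G V₁ V₂ : Type*} [Group G] [NormedAddCommGroup V₁] [InnerProductSpace ℝ V₁]
  [NormedAddCommGroup V₂] [InnerProductSpace ℝ V₂]

/-- The inclusion of the first factor of an orthogonal sum. -/
def inlIsometry : V₁ →ₗᵢ[ℝ] WithLp 2 (V₁ × V₂) where
  toLinearMap := (WithLp.linearEquiv 2 ℝ (V₁ × V₂)).symm.toLinearMap ∘ₗ LinearMap.inl ℝ V₁ V₂
  norm_map' v := by simp

/-- The inclusion of the second factor of an orthogonal sum. -/
def inrIsometry : V₂ →ₗᵢ[ℝ] WithLp 2 (V₁ × V₂) where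
  toLinearMap := (WithLp.linearEquiv 2 ℝ (V₁ × V₂)).symm.toLinearMap ∘ₗ LinearMap.inr ℝ V₁ V₂
  norm_map' v := by simp

/-- The orthogonal sum of two representations. -/
def orthogonalSum (ρ₁ : Representation ℝ G V₁) (ρ₂ : Representation ℝ G V₂) :
    Representation ℝ G (WithLp 2 (V₁ × V₂)) where
  toFun g := (WithLp.linearEquiv 2 ℝ (V₁ × V₂)).symm.toLinearMap ∘ₗ
    (ρ₁ g).prodMap (ρ₂ g) ∘ₗ (WithLp.linearEquiv 2 ℝ (V₁ × V₂)).toLinearMap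
  map_one' := by
    ext
    simp
  map_mul' g h := by
    ext
    simp

theorem fst_inlIsometry (a : V₁) : (inlIsometry a : WithLp 2 (V₁ × V₂)).fst = a := rfl
theorem snd_inlIsometry (a : V₁) : (inlIsometry a : WithLp 2 (V₁ × V₂)).snd = 0 := rfl
theorem fst_inrIsometry (b : V₂) : (inrIsometry b : WithLp 2 (V₁ × V₂)).fst = 0 := rfl
theorem snd_inrIsometry (b : V₂) : (inrIsometry b : WithLp 2 (V₁ × V₂)).snd = b := rfl

theorem inl_add_inr (w : WithLp 2 (V₁ × V₂)) : inlIsometry w.fst + inrIsometry w.snd = w := by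
  refine WithLp.ofLp_injective _ (Prod.ext ?_ ?_)
  · change w.fst + 0 = w.fst; simp
  · change 0 + w.snd = w.snd; simp

theorem inner_orthogonalSum (v w : WithLp 2 (V₁ × V₂)) :
    inner ℝ v w = inner ℝ v.fst w.fst + inner ℝ v.snd w.snd := WithLp.prod_inner_apply v w

variable {ρ₁ : Representation ℝ G V₁} {ρ₂ : Representation ℝ G V₂}

theorem fst_orthogonalSum (g : G) (w : WithLp 2 (V₁ × V₂)) :
    (orthogonalSum ρ₁ ρ₂ g w).fst = ρ₁ g w.fst := rfl
theorem snd_orthogonalSum (g : G) (w : WithLp 2 (V₁ × V₂)) :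
    (orthogonalSum ρ₁ ρ₂ g w).snd = ρ₂ g w.snd := rfl

theorem inl_equivariant (g : G) (a : V₁) :
    (inlIsometry (ρ₁ g a) : WithLp 2 (V₁ × V₂)) = orthogonalSum ρ₁ ρ₂ g (inlIsometry a) := by
  refine WithLp.ofLp_injective _ (Prod.ext rfl ?_)
  change 0 = ρ₂ g 0
  simp

theorem inr_equivariant (g : G) (b : V₂) :
    (inrIsometry (ρ₂ g b) : WithLp 2 (V₁ × V₂)) = orthogonalSum ρ₁ ρ₂ g (inrIsometry b) := by
  refine WithLp.ofLp_injective _ (Prod.ext ?_ rfl)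
  change 0 = ρ₁ g 0
  simp

theorem isotropyGroup_orthogonalSum (w : WithLp 2 (V₁ × V₂)) :
    (orthogonalSum ρ₁ ρ₂).isotropyGroup w = ρ₁.isotropyGroup w.fst ⊓ ρ₂.isotropyGroup w.snd := by
  ext g
  rw [Subgroup.mem_inf, mem_isotropyGroup, mem_isotropyGroup, mem_isotropyGroup]
  constructor
  · intro h
    exact ⟨congrArg WithLp.fst h, congrArg WithLp.snd h⟩
  · rintro ⟨h1, h2⟩
    exact WithLp.ofLp_injective _ (Prod.ext h1 h2)

end Product

end Representation

/-! ### The orthogonal sum near a point with one component of principal isotropy. -/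

namespace Representation

variable {G V₁ V₂ : Type*} [Group G] [NormedAddCommGroup V₁] [InnerProductSpace ℝ V₁]
  [FiniteDimensional ℝ V₁] [NormedAddCommGroup V₂] [InnerProductSpace ℝ V₂]
  [FiniteDimensional ℝ V₂] {ρ₁ : Representation ℝ G V₁} {ρ₂ : Representation ℝ G V₂}

omit [FiniteDimensional ℝ V₁] [FiniteDimensional ℝ V₂] in
theorem isotropyGroup_inr (x : V₂) :
    (orthogonalSum ρ₁ ρ₂).isotropyGroup (inrIsometry x) = ρ₂.isotropyGroup x :=
  isotropyGroup_of_equivariant inrIsometry.injective inr_equivariant x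

theorem mem_normalSpace_inr {x : V₂} {w : WithLp 2 (V₁ × V₂)} :
    w ∈ (orthogonalSum ρ₁ ρ₂).normalSpace (inrIsometry x) ↔ w.snd ∈ ρ₂.normalSpace x := by
  simp only [normalSpace, Submodule.mem_orthogonal, 
    mem_tangentSpace_isometry (inr_equivariant (ρ₁ := ρ₁) (ρ₂ := ρ₂))]
  constructor
  · intro h t ht
    simpa [inner_orthogonalSum, fst_inrIsometry, snd_inrIsometry] using h _ ⟨t, ht, rfl⟩
  · rintro h _ ⟨t, ht, rfl⟩
    simpa [inner_orthogonalSum, fst_inrIsometry, snd_inrIsometry] using h t ht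

theorem finrank_normalSpace_inr (x : V₂) :
    Module.finrank ℝ ((orthogonalSum ρ₁ ρ₂).normalSpace (inrIsometry x)) =
      Module.finrank ℝ V₁ + Module.finrank ℝ (ρ₂.normalSpace x) := by
  have h1 := (orthogonalSum ρ₁ ρ₂).finrank_tangentSpace_add_finrank_normalSpace (inrIsometry x)
  have h2 := ρ₂.finrank_tangentSpace_add_finrank_normalSpace x
  have h3 := finrank_tangentSpace_isometry (π := orthogonalSum ρ₁ ρ₂) (inr_equivariant (ρ₁ := ρ₁)) x
  have h4 : Module.finrank ℝ (WithLp 2 (V₁ × V₂)) =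
      Module.finrank ℝ V₁ + Module.finrank ℝ V₂ := by
    rw [(WithLp.linearEquiv 2 ℝ (V₁ × V₂)).finrank_eq, Module.finrank_prod]
  omega

namespace IsCompactOrthogonal

variable (hπ : (orthogonalSum ρ₁ ρ₂).IsCompactOrthogonal)
include hπ

theorem snd_lieAlgebra_inl {A : WithLp 2 (V₁ × V₂) →L[ℝ] WithLp 2 (V₁ × V₂)}
    (hA : A ∈ (orthogonalSum ρ₁ ρ₂).lieAlgebra) (a : V₁) : (A (inlIsometry a)).snd = 0 := by
  obtain ⟨t, -, ht⟩ := (mem_tangentSpace_isometry (inl_equivariant (ρ₁ := ρ₁) (ρ₂ := ρ₂))).1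
    (hπ.mem_tangentSpace.2 ⟨A, hA, rfl⟩)
  rw [← ht, snd_inlIsometry]

theorem fst_lieAlgebra_inr {A : WithLp 2 (V₁ × V₂) →L[ℝ] WithLp 2 (V₁ × V₂)}
    (hA : A ∈ (orthogonalSum ρ₁ ρ₂).lieAlgebra) (b : V₂) : (A (inrIsometry b)).fst = 0 := by
  obtain ⟨t, -, ht⟩ := (mem_tangentSpace_isometry (inr_equivariant (ρ₁ := ρ₁) (ρ₂ := ρ₂))).1
    (hπ.mem_tangentSpace.2 ⟨A, hA, rfl⟩)
  rw [← ht, fst_inrIsometry]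

theorem inner_lieAlgebra_orthogonalSum {A : WithLp 2 (V₁ × V₂) →L[ℝ] WithLp 2 (V₁ × V₂)}
    (hA : A ∈ (orthogonalSum ρ₁ ρ₂).lieAlgebra) (p w : WithLp 2 (V₁ × V₂)) :
    inner ℝ (A p) w = inner ℝ (A (inlIsometry p.fst)) (inlIsometry w.fst) +
      inner ℝ (A (inrIsometry p.snd)) (inrIsometry w.snd) := by
  conv_lhs => rw [← inl_add_inr p, map_add, inner_add_left]
  simp only [inner_orthogonalSum, hπ.snd_lieAlgebra_inl hA, hπ.fst_lieAlgebra_inr hA,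
    fst_inlIsometry, snd_inrIsometry, inner_zero_left, zero_add, add_zero]

/-- The Lie algebra preserves both factors, so the second component of p does not contribute. The
two normal spaces of the components thus sit orthogonally inside the normal space at p, as the
codimension one dichotomy needs. -/
theorem inl_mem_normalSpace_iff {p : WithLp 2 (V₁ × V₂)} {a : V₁} :
    inlIsometry a ∈ (orthogonalSum ρ₁ ρ₂).normalSpace p ↔ a ∈ ρ₁.normalSpace p.fst := by
  rw [mem_normalSpace_isometry inl_equivariant (π := orthogonalSum ρ₁ ρ₂), hπ.mem_normalSpace,
    hπ.mem_normalSpace]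
  refine forall₂_congr fun A hA => ?_
  rw [hπ.inner_lieAlgebra_orthogonalSum hA p, snd_inlIsometry, fst_inlIsometry, map_zero,
    inner_zero_right, add_zero]

theorem inr_mem_normalSpace_iff {p : WithLp 2 (V₁ × V₂)} {b : V₂} :
    inrIsometry b ∈ (orthogonalSum ρ₁ ρ₂).normalSpace p ↔ b ∈ ρ₂.normalSpace p.snd := by
  rw [mem_normalSpace_isometry inr_equivariant (π := orthogonalSum ρ₁ ρ₂), hπ.mem_normalSpace,
    hπ.mem_normalSpace]
  refine forall₂_congr fun A hA => ?_
  rw [hπ.inner_lieAlgebra_orthogonalSum hA p, snd_inrIsometry, fst_inrIsometry, map_zero,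
    inner_zero_right, zero_add]

theorem restrict_isotropyGroup_snd (x : V₂) :
    ((orthogonalSum ρ₁ ρ₂).restrictSubgroup (ρ₂.isotropyGroup x)).IsCompactOrthogonal := by
  have := hπ.restrict_isotropyGroup (inrIsometry x)
  rwa [isotropyGroup_inr] at this

theorem mem_lieAlgebra_restrict_snd {x : V₂}
    {A : WithLp 2 (V₁ × V₂) →L[ℝ] WithLp 2 (V₁ × V₂)} :
    A ∈ ((orthogonalSum ρ₁ ρ₂).restrictSubgroup (ρ₂.isotropyGroup x)).lieAlgebra ↔
      A ∈ (orthogonalSum ρ₁ ρ₂).lieAlgebra ∧ A (inrIsometry x) = 0 := by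
  rw [← hπ.mem_lieAlgebra_restrict, isotropyGroup_inr]

theorem restrict_fst (x : V₂) :
    (ρ₁.restrictSubgroup (ρ₂.isotropyGroup x)).IsCompactOrthogonal :=
  .of_isometry (restrictSubgroup_equivariant inl_equivariant _) (hπ.restrict_isotropyGroup_snd x)

/-- The isotropy group of x acts trivially on its normal space, so its Lie algebra kills the second
component of w. -/
theorem tangentSpace_restrict_eq {x : V₂}
    (hx : ρ₂.normalSpace x ≤ ρ₂.fixedSpace (ρ₂.isotropyGroup x)) {w : WithLp 2 (V₁ × V₂)}
    (hw : w.snd ∈ ρ₂.normalSpace x) :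
    ((orthogonalSum ρ₁ ρ₂).restrictSubgroup (ρ₂.isotropyGroup x)).tangentSpace w =
      ((orthogonalSum ρ₁ ρ₂).restrictSubgroup (ρ₂.isotropyGroup x)).tangentSpace
        (inlIsometry w.fst) := by
  have hτ := hπ.restrict_isotropyGroup_snd x
  have key : ∀ A ∈ ((orthogonalSum ρ₁ ρ₂).restrictSubgroup (ρ₂.isotropyGroup x)).lieAlgebra,
      A w = A (inlIsometry w.fst) := by
    intro A hA
    have h0 : A (inrIsometry w.snd) = 0 := apply_eq_zero_of_exp_smul fun t => by
      obtain ⟨g, hg⟩ := hτ.exists_exp_eq hA t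
      rw [← hg, toCLM_apply, restrictSubgroup_apply, ← inr_equivariant, hx hw g g.2]
    conv_lhs => rw [← inl_add_inr w, map_add, h0, add_zero]
  ext v
  rw [hτ.mem_tangentSpace, hτ.mem_tangentSpace]
  constructor
  · rintro ⟨A, hA, rfl⟩
    exact ⟨A, hA, (key A hA).symm⟩
  · rintro ⟨A, hA, rfl⟩
    exact ⟨A, hA, key A hA⟩

/-- Orbit spaces near a point with principal isotropy in the second factor: the dimension. -/
theorem orbitSpaceDim_orthogonalSum {x : V₂}
    (hx : ρ₂.normalSpace x ≤ ρ₂.fixedSpace (ρ₂.isotropyGroup x)) :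
    (orthogonalSum ρ₁ ρ₂).orbitSpaceDim =
      (ρ₁.restrictSubgroup (ρ₂.isotropyGroup x)).orbitSpaceDim +
        Module.finrank ℝ (ρ₂.normalSpace x) := by
  set σ := ρ₁.restrictSubgroup (ρ₂.isotropyGroup x) with hσ
  -- The slice representation at (0, x) is V₁ plus the normal space of x, the latter acted on
  -- trivially, so its orbits are seen in V₁ alone.
  have hT : ∀ w : WithLp 2 (V₁ × V₂), w.snd ∈ ρ₂.normalSpace x →
      Module.finrank ℝ (((orthogonalSum ρ₁ ρ₂).restrictSubgroup
        ((orthogonalSum ρ₁ ρ₂).isotropyGroup (inrIsometry x))).tangentSpace w) =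
      Module.finrank ℝ (σ.tangentSpace w.fst) := by
    intro w hw
    rw [isotropyGroup_inr, hπ.tangentSpace_restrict_eq hx hw]
    exact finrank_tangentSpace_isometry (restrictSubgroup_equivariant inl_equivariant _) _
  have hn := finrank_normalSpace_inr (ρ₁ := ρ₁) (ρ₂ := ρ₂) x
  apply le_antisymm
  · obtain ⟨a, ha⟩ := σ.exists_orbitSpaceDim_eq
    have hmem : (inlIsometry a : WithLp 2 (V₁ × V₂)) ∈
        (orthogonalSum ρ₁ ρ₂).normalSpace (inrIsometry x) := by
      rw [mem_normalSpace_inr, snd_inlIsometry]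
      exact zero_mem _
    have h1 := hπ.orbitSpaceDim_add_le hmem
    rw [hT _ (mem_normalSpace_inr.1 hmem), fst_inlIsometry] at h1
    have h2 := σ.finrank_tangentSpace_add_finrank_normalSpace a
    omega
  · obtain ⟨w, hw, h1⟩ := hπ.exists_orbitSpaceDim_add_eq (inrIsometry x)
    rw [hT _ (mem_normalSpace_inr.1 hw)] at h1
    have h2 := σ.finrank_tangentSpace_add_finrank_normalSpace w.fst
    have h3 := σ.orbitSpaceDim_le w.fst
    omega

theorem fst_mem_fixedNormalSpace {p v : WithLp 2 (V₁ × V₂)}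
    (hv : v ∈ (orthogonalSum ρ₁ ρ₂).fixedNormalSpace p) :
    v.fst ∈ (ρ₁.restrictSubgroup (ρ₂.isotropyGroup p.snd)).fixedNormalSpace p.fst := by
  have hτ := hπ.restrict_isotropyGroup_snd p.snd
  refine ⟨?_, fun h hh => ?_⟩
  · rw [SetLike.mem_coe, mem_normalSpace_isometry (restrictSubgroup_equivariant inl_equivariant _)
      (π := (orthogonalSum ρ₁ ρ₂).restrictSubgroup (ρ₂.isotropyGroup p.snd)), hτ.mem_normalSpace]
    intro A hA
    obtain ⟨hA, hA0⟩ := hπ.mem_lieAlgebra_restrict_snd.1 hA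
    have h1 := hπ.mem_normalSpace.1 hv.1 A hA
    rwa [hπ.inner_lieAlgebra_orthogonalSum hA, hA0, inner_zero_left, add_zero] at h1
  · have hmem : (h : G) ∈ (orthogonalSum ρ₁ ρ₂).isotropyGroup p := by
      rw [isotropyGroup_orthogonalSum]
      exact ⟨hh, h.2⟩
    exact congrArg WithLp.fst (hv.2 h hmem)

/-- By duality, it suffices to test (a, 0) against orbit tangent vectors A p with zero second
component. Such A kills the second component of p, so it lies in the Lie algebra of that component's
isotropy group, to whose orbit a is normal. -/
theorem exists_mem_normalSpace_fst_eq {p : WithLp 2 (V₁ × V₂)} {a : V₁}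
    (ha : a ∈ (ρ₁.restrictSubgroup (ρ₂.isotropyGroup p.snd)).normalSpace p.fst) :
    ∃ v ∈ (orthogonalSum ρ₁ ρ₂).normalSpace p, v.fst = a := by
  have hτ := hπ.restrict_isotropyGroup_snd p.snd
  set R : Submodule ℝ (WithLp 2 (V₁ × V₂)) := LinearMap.range inrIsometry.toLinearMap with hR
  have hmem : (inlIsometry a : WithLp 2 (V₁ × V₂)) ∈
      (orthogonalSum ρ₁ ρ₂).normalSpace p ⊔ R := by
    rw [← Submodule.orthogonal_orthogonal ((orthogonalSum ρ₁ ρ₂).normalSpace p ⊔ R),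
      Submodule.mem_orthogonal, ← Submodule.inf_orthogonal, normalSpace,
      Submodule.orthogonal_orthogonal]
    rintro w ⟨hw, hwR⟩
    obtain ⟨A, hA, rfl⟩ := hπ.mem_tangentSpace.1 hw
    have hsnd : ∀ b : V₂, inner ℝ (A (inrIsometry p.snd)) (inrIsometry b) = 0 := fun b => by
      have h1 := (Submodule.mem_orthogonal' _ _).1 hwR (inrIsometry b) ⟨b, rfl⟩
      rwa [hπ.inner_lieAlgebra_orthogonalSum hA, fst_inrIsometry, snd_inrIsometry, map_zero,
        inner_zero_right, zero_add] at h1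
    have hA0 : A (inrIsometry p.snd) = 0 := by
      have h1 := hsnd (A (inrIsometry p.snd)).snd
      rw [inner_orthogonalSum, snd_inrIsometry, fst_inrIsometry, inner_zero_right, zero_add,
        inner_self_eq_zero] at h1
      rw [← inl_add_inr (A (inrIsometry p.snd)), h1, hπ.fst_lieAlgebra_inr hA, map_zero, map_zero,
        add_zero]
    rw [mem_normalSpace_isometry (restrictSubgroup_equivariant inl_equivariant _)
      (π := (orthogonalSum ρ₁ ρ₂).restrictSubgroup (ρ₂.isotropyGroup p.snd)),
      hτ.mem_normalSpace] at ha
    rw [hπ.inner_lieAlgebra_orthogonalSum hA, hA0, inner_zero_left, add_zero, fst_inlIsometry]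
    exact ha A (hπ.mem_lieAlgebra_restrict_snd.2 ⟨hA, hA0⟩)
  obtain ⟨v, hv, _, ⟨b, rfl⟩, hvb⟩ := Submodule.mem_sup.1 hmem
  refine ⟨v, hv, ?_⟩
  have h1 := congrArg WithLp.fst hvb
  change v.fst + 0 = a at h1
  simpa using h1

/-- Orbit spaces near a point with principal isotropy in the second factor: the strata. -/
theorem finrank_fixedNormalSpace_orthogonalSum {p : WithLp 2 (V₁ × V₂)}
    (hx : ρ₂.normalSpace p.snd ≤ ρ₂.fixedSpace (ρ₂.isotropyGroup p.snd)) :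
    Module.finrank ℝ ((orthogonalSum ρ₁ ρ₂).fixedNormalSpace p) =
      Module.finrank ℝ
        ((ρ₁.restrictSubgroup (ρ₂.isotropyGroup p.snd)).fixedNormalSpace p.fst) +
        Module.finrank ℝ (ρ₂.normalSpace p.snd) := by
  have hL : (orthogonalSum ρ₁ ρ₂).isotropyGroup p ≤ ρ₂.isotropyGroup p.snd := by
    rw [isotropyGroup_orthogonalSum]
    exact inf_le_right
  have hinr : ∀ b, (inrIsometry b : WithLp 2 (V₁ × V₂)) ∈ (orthogonalSum ρ₁ ρ₂).normalSpace p →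
      ∀ h ∈ ρ₂.isotropyGroup p.snd,
        orthogonalSum ρ₁ ρ₂ h (inrIsometry b) = inrIsometry b := by
    intro b hb h hh
    rw [← inr_equivariant, hx (hπ.inr_mem_normalSpace_iff.1 hb) h hh]
  have heq : ∀ w : WithLp 2 (V₁ × V₂), w.fst = 0 → w = inrIsometry w.snd := by
    intro w hw
    conv_lhs => rw [← inl_add_inr w, hw, map_zero, zero_add]
  set f : WithLp 2 (V₁ × V₂) →ₗ[ℝ] V₁ :=
    LinearMap.fst ℝ V₁ V₂ ∘ₗ (WithLp.linearEquiv 2 ℝ (V₁ × V₂)).toLinearMap with hf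
  have hfapp : ∀ w, f w = w.fst := fun _ => rfl
  rw [← finrank_map_add_finrank_inf_ker f]
  congr 1
  · suffices h : ((orthogonalSum ρ₁ ρ₂).fixedNormalSpace p).map f =
        (ρ₁.restrictSubgroup (ρ₂.isotropyGroup p.snd)).fixedNormalSpace p.fst by rw [h]
    ext a
    constructor
    · rintro ⟨v, hv, rfl⟩
      exact hπ.fst_mem_fixedNormalSpace hv
    · intro ha
      obtain ⟨v, hv, rfl⟩ := hπ.exists_mem_normalSpace_fst_eq ha.1
      refine ⟨v, ⟨hv, fun h hh => ?_⟩, rfl⟩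
      have hsub : orthogonalSum ρ₁ ρ₂ h v - v ∈ (orthogonalSum ρ₁ ρ₂).normalSpace p := by
        have h1 := hπ.map_mem_normalSpace h hv
        rw [show orthogonalSum ρ₁ ρ₂ h p = p from hh] at h1
        exact Submodule.sub_mem _ h1 hv
      have hfst : (orthogonalSum ρ₁ ρ₂ h v - v).fst = 0 := by
        have h1 := ha.2 ⟨h, hL hh⟩ (by
          rw [isotropyGroup_orthogonalSum] at hh
          exact hh.1)
        exact sub_eq_zero.2 h1
      have hr := heq _ hfst
      set r := orthogonalSum ρ₁ ρ₂ h v - v with hrdef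
      have hrfix : orthogonalSum ρ₁ ρ₂ h⁻¹ r = r := by
        rw [hr] at hsub ⊢
        exact hinr _ hsub _ (inv_mem (hL hh))
      -- The defect r = h v - v has zero first component and is normal, so h fixes it. Then ⟨h v, r⟩
      -- = ⟨v, r⟩ and r is orthogonal to itself.
      have h0 : inner ℝ r r = 0 := by
        conv_lhs => rw [hrdef, inner_sub_left, ← hrdef, hπ.inner_map_left, hrfix, sub_self]
      rw [inner_self_eq_zero] at h0
      exact sub_eq_zero.1 h0
  · suffices h : ((orthogonalSum ρ₁ ρ₂).fixedNormalSpace p) ⊓ LinearMap.ker f =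
        (ρ₂.normalSpace p.snd).map inrIsometry.toLinearMap by
      rw [h]
      exact finrank_map_of_injective inrIsometry.injective _
    ext w
    constructor
    · rintro ⟨hw, hw0⟩
      have h1 := heq w hw0
      refine ⟨w.snd, ?_, h1.symm⟩
      have h2 := hw.1
      rw [h1] at h2
      exact hπ.inr_mem_normalSpace_iff.1 h2
    · rintro ⟨b, hb, rfl⟩
      have h1 := hπ.inr_mem_normalSpace_iff.2 hb
      exact ⟨⟨h1, fun h hh => hinr b h1 h (hL hh)⟩, rfl⟩

theorem hasCodimOneStratum_orthogonalSum_iff {p : WithLp 2 (V₁ × V₂)}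
    (hx : ρ₂.normalSpace p.snd ≤ ρ₂.fixedSpace (ρ₂.isotropyGroup p.snd)) :
    (orthogonalSum ρ₁ ρ₂).HasCodimOneStratum p ↔
      (ρ₁.restrictSubgroup (ρ₂.isotropyGroup p.snd)).HasCodimOneStratum p.fst := by
  rw [hπ.hasCodimOneStratum_iff, (hπ.restrict_fst p.snd).hasCodimOneStratum_iff,
    hπ.orbitSpaceDim_orthogonalSum hx, hπ.finrank_fixedNormalSpace_orthogonalSum hx]
  omega

/-- If there is a stratum of codimension one, then there is one through a point with a component
of principal isotropy. -/
theorem exists_hasCodimOneStratum_principal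
    (hex : ∃ p, (orthogonalSum ρ₁ ρ₂).HasCodimOneStratum p) :
    ∃ p, (orthogonalSum ρ₁ ρ₂).HasCodimOneStratum p ∧
      (ρ₁.normalSpace p.fst ≤ ρ₁.fixedSpace (ρ₁.isotropyGroup p.fst) ∨
        ρ₂.normalSpace p.snd ≤ ρ₂.fixedSpace (ρ₂.isotropyGroup p.snd)) := by
  -- The dimensions are bounded, so a maximum over codimension one points exists. Moving one
  -- component leaves the other summand unchanged, so maximality controls each fixed space
  -- separately.
  set F : WithLp 2 (V₁ × V₂) → ℕ := fun p =>
    Module.finrank ℝ (ρ₁.fixedSpace (ρ₁.isotropyGroup p.fst)) +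
      Module.finrank ℝ (ρ₂.fixedSpace (ρ₂.isotropyGroup p.snd)) with hF
  have hbdd : BddAbove (F '' {p | (orthogonalSum ρ₁ ρ₂).HasCodimOneStratum p}) := by
    refine ⟨Module.finrank ℝ V₁ + Module.finrank ℝ V₂, ?_⟩
    rintro _ ⟨p, -, rfl⟩
    exact add_le_add (Submodule.finrank_le _) (Submodule.finrank_le _)
  obtain ⟨p, hp, hpmax⟩ := Nat.sSup_mem (Set.Nonempty.image F hex) hbdd
  have hmax : ∀ q, (orthogonalSum ρ₁ ρ₂).HasCodimOneStratum q → F q ≤ F p := fun q hq => by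
    rw [hpmax]
    exact le_csSup hbdd ⟨q, hq, rfl⟩
  refine ⟨p, hp, ?_⟩
  set N₁ := (ρ₁.normalSpace p.fst).map (inlIsometry (V₂ := V₂)).toLinearMap with hN₁
  set N₂ := (ρ₂.normalSpace p.snd).map (inrIsometry (V₁ := V₁)).toLinearMap with hN₂
  have h₁ : N₁ ≤ (orthogonalSum ρ₁ ρ₂).normalSpace p := by
    rintro _ ⟨a, ha, rfl⟩
    exact hπ.inl_mem_normalSpace_iff.2 ha
  have h₂ : N₂ ≤ (orthogonalSum ρ₁ ρ₂).normalSpace p := by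
    rintro _ ⟨a, ha, rfl⟩
    exact hπ.inr_mem_normalSpace_iff.2 ha
  have horth : N₁ ⟂ N₂ := by
    rw [Submodule.isOrtho_iff_inner_eq]
    rintro _ ⟨a, -, rfl⟩ _ ⟨b, -, rfl⟩
    change inner ℝ (inlIsometry a) (inrIsometry b) = 0
    rw [inner_orthogonalSum, fst_inrIsometry, snd_inlIsometry, inner_zero_left, inner_zero_right,
      add_zero]
  have hinv₁ : ∀ g ∈ (orthogonalSum ρ₁ ρ₂).isotropyGroup p, ∀ u ∈ N₁,
      orthogonalSum ρ₁ ρ₂ g u ∈ N₁ := by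
    rintro g hg _ ⟨a, ha, rfl⟩
    refine ⟨ρ₁ g a, ?_, inl_equivariant g a⟩
    have h1 := (IsCompactOrthogonal.of_isometry inl_equivariant hπ).map_mem_normalSpace g ha
    rw [isotropyGroup_orthogonalSum] at hg
    rwa [show ρ₁ g p.fst = p.fst from hg.1] at h1
  have hinv₂ : ∀ g ∈ (orthogonalSum ρ₁ ρ₂).isotropyGroup p, ∀ u ∈ N₂,
      orthogonalSum ρ₁ ρ₂ g u ∈ N₂ := by
    rintro g hg _ ⟨a, ha, rfl⟩
    refine ⟨ρ₂ g a, ?_, inr_equivariant g a⟩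
    have h1 := (IsCompactOrthogonal.of_isometry inr_equivariant hπ).map_mem_normalSpace g ha
    rw [isotropyGroup_orthogonalSum] at hg
    rwa [show ρ₂ g p.snd = p.snd from hg.2] at h1
  rcases hπ.le_fixedSpace_or_le_fixedSpace hp h₁ h₂ horth hinv₁ hinv₂ with hfix | hfix
  · refine Or.inl (hπ.normalSpace_le_fixedSpace_of_maximal inl_equivariant hp
      (fun v hv => ⟨h₁ ⟨v, hv, rfl⟩, hfix ⟨v, hv, rfl⟩⟩) fun v hv => ?_)
    have h1 := hmax _ hv
    change Module.finrank ℝ (ρ₁.fixedSpace (ρ₁.isotropyGroup (p.fst + v))) +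
      Module.finrank ℝ (ρ₂.fixedSpace (ρ₂.isotropyGroup (p.snd + 0))) ≤ _ at h1
    rw [add_zero] at h1
    simp only [hF] at h1
    omega
  · refine Or.inr (hπ.normalSpace_le_fixedSpace_of_maximal inr_equivariant hp
      (fun v hv => ⟨h₂ ⟨v, hv, rfl⟩, hfix ⟨v, hv, rfl⟩⟩) fun v hv => ?_)
    have h1 := hmax _ hv
    change Module.finrank ℝ (ρ₁.fixedSpace (ρ₁.isotropyGroup (p.fst + 0))) +
      Module.finrank ℝ (ρ₂.fixedSpace (ρ₂.isotropyGroup (p.snd + v))) ≤ _ at h1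
    rw [add_zero] at h1
    simp only [hF] at h1
    omega

end IsCompactOrthogonal

end Representation

/-! ### From strata to boundaries, and the theorem. -/

namespace Representation

theorem orbitSpaceBoundary_nonempty_iff {G V : Type*} [Group G] [NormedAddCommGroup V]
    [NormedSpace ℝ V] (ρ : Representation ℝ G V) :
    ρ.orbitSpaceBoundary.Nonempty ↔ ∃ p, ρ.HasCodimOneStratum p := by
  rw [orbitSpaceBoundary, closure_nonempty_iff]
  constructor
  · rintro ⟨_, hx⟩
    simp only [Set.mem_iUnion] at hx
    obtain ⟨p, hp, -⟩ := hx
    exact ⟨p, hp⟩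
  · rintro ⟨p, hp⟩
    refine ⟨Quotient.mk _ p, Set.mem_iUnion₂.2 ⟨p, hp, p, ?_, rfl⟩⟩
    exact ρ.mem_isotropyStratum_iff.2 ⟨1, by rw [map_one, Module.End.one_apply]⟩

theorem isCompactOrthogonal_of_continuous {G V : Type*} [Group G] [TopologicalSpace G]
    [CompactSpace G] [NormedAddCommGroup V] [InnerProductSpace ℝ V] [FiniteDimensional ℝ V]
    {ρ : Representation ℝ G V} (hcont : ∀ v : V, Continuous fun g : G => ρ g v)
    (horth : ∀ (g : G) (v w : V), inner ℝ (ρ g v) (ρ g w) = inner ℝ v w) :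
    ρ.IsCompactOrthogonal where
  inner_map_map := horth
  isCompact_range := isCompact_range (continuous_clm_apply.2 hcont)

section Product

variable {G V₁ V₂ : Type*} [Group G] [NormedAddCommGroup V₁] [InnerProductSpace ℝ V₁]
  [FiniteDimensional ℝ V₁] [NormedAddCommGroup V₂] [InnerProductSpace ℝ V₂]
  [FiniteDimensional ℝ V₂] {ρ₁ : Representation ℝ G V₁} {ρ₂ : Representation ℝ G V₂}

/-- Exchanging the factors of an orthogonal sum. -/
def orthogonalSumComm : WithLp 2 (V₁ × V₂) ≃ₗ[ℝ] WithLp 2 (V₂ × V₁) :=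
  (WithLp.linearEquiv 2 ℝ (V₁ × V₂)).trans
    ((LinearEquiv.prodComm ℝ V₁ V₂).trans (WithLp.linearEquiv 2 ℝ (V₂ × V₁)).symm)

theorem hasCodimOneStratum_orthogonalSumComm (p : WithLp 2 (V₁ × V₂)) :
    (orthogonalSum ρ₂ ρ₁).HasCodimOneStratum (orthogonalSumComm p) ↔
      (orthogonalSum ρ₁ ρ₂).HasCodimOneStratum p := by
  have h : ∀ g (w : WithLp 2 (V₁ × V₂)), orthogonalSumComm (orthogonalSum ρ₁ ρ₂ g w) =
      orthogonalSum ρ₂ ρ₁ g (orthogonalSumComm w) := fun g w => by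
    refine WithLp.ofLp_injective _ (Prod.ext ?_ ?_)
    · rfl
    · rfl
  have h' := hasCodimOneStratum_of_equivariant (σ := orthogonalSum ρ₁ ρ₂)
    (π := orthogonalSum ρ₂ ρ₁) orthogonalSumComm h
  exact h' p

theorem IsCompactOrthogonal.exists_hasCodimOneStratum_restrict_iff
    (hπ : (orthogonalSum ρ₁ ρ₂).IsCompactOrthogonal) {H : Subgroup G}
    (hH : ρ₂.IsPrincipalIsotropyGroup H) :
    (∃ p, (orthogonalSum ρ₁ ρ₂).HasCodimOneStratum p ∧
      ρ₂.normalSpace p.snd ≤ ρ₂.fixedSpace (ρ₂.isotropyGroup p.snd)) ↔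
      ∃ a, (ρ₁.restrictSubgroup H).HasCodimOneStratum a := by
  have hρ₂ : ρ₂.IsCompactOrthogonal := .of_isometry inr_equivariant hπ
  constructor
  · rintro ⟨p, hp, hx⟩
    obtain ⟨g, rfl⟩ := hρ₂.exists_isotropyGroup_apply_eq hx hH
    -- A principal isotropy group is unique only up to conjugation; moving p along its orbit makes
    -- the isotropy of the second component equal to H itself.
    rw [← hasCodimOneStratum_apply_iff _ g] at hp
    have hx' := (hρ₂.isPrincipalIsotropyGroup_iff _).1 hH
    rw [← snd_orthogonalSum (ρ₁ := ρ₁)] at hx' ⊢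
    exact ⟨_, (hπ.hasCodimOneStratum_orthogonalSum_iff hx').1 hp⟩
  · rintro ⟨a, ha⟩
    obtain ⟨x, rfl⟩ := hH.1
    have hx := (hρ₂.isPrincipalIsotropyGroup_iff x).1 hH
    have h := hπ.hasCodimOneStratum_orthogonalSum_iff (p := WithLp.toLp 2 (a, x)) hx
    exact ⟨WithLp.toLp 2 (a, x), h.2 ha, hx⟩

theorem exists_hasCodimOneStratum_orthogonalSum_iff
    (hπ : (orthogonalSum ρ₁ ρ₂).IsCompactOrthogonal)
    (hπ' : (orthogonalSum ρ₂ ρ₁).IsCompactOrthogonal) {H₁ H₂ : Subgroup G}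
    (hH₁ : ρ₁.IsPrincipalIsotropyGroup H₁) (hH₂ : ρ₂.IsPrincipalIsotropyGroup H₂) :
    (∃ p, (orthogonalSum ρ₁ ρ₂).HasCodimOneStratum p) ↔
      (∃ a, (ρ₁.restrictSubgroup H₂).HasCodimOneStratum a) ∨
        ∃ b, (ρ₂.restrictSubgroup H₁).HasCodimOneStratum b := by
  rw [← hπ.exists_hasCodimOneStratum_restrict_iff hH₂,
    ← hπ'.exists_hasCodimOneStratum_restrict_iff hH₁]
  constructor
  · intro h
    obtain ⟨p, hp, h | h⟩ := hπ.exists_hasCodimOneStratum_principal h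
    -- A principal first component exhibits the codimension one stratum in Y₂, and a principal
    -- second component in Y₁.
    · exact Or.inr ⟨orthogonalSumComm p, (hasCodimOneStratum_orthogonalSumComm p).2 hp, h⟩
    · exact Or.inl ⟨p, hp, h⟩
  · rintro (⟨p, hp, -⟩ | ⟨p, hp, -⟩)
    · exact ⟨p, hp⟩
    · exact ⟨_, (hasCodimOneStratum_orthogonalSumComm p).2 hp⟩

theorem isCompactOrthogonal_orthogonalSum [TopologicalSpace G] [CompactSpace G]
    (hc₁ : ∀ v : V₁, Continuous fun g : G => ρ₁ g v)
    (hc₂ : ∀ v : V₂, Continuous fun g : G => ρ₂ g v)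
    (ho₁ : ∀ (g : G) (v w : V₁), inner ℝ (ρ₁ g v) (ρ₁ g w) = inner ℝ v w)
    (ho₂ : ∀ (g : G) (v w : V₂), inner ℝ (ρ₂ g v) (ρ₂ g w) = inner ℝ v w) :
    (orthogonalSum ρ₁ ρ₂).IsCompactOrthogonal := by
  refine isCompactOrthogonal_of_continuous (fun v => ?_) fun g v w => ?_
  · exact (WithLp.prod_continuous_toLp 2 V₁ V₂).comp ((hc₁ v.fst).prodMk (hc₂ v.snd))
  · rw [inner_orthogonalSum, inner_orthogonalSum v w, fst_orthogonalSum, fst_orthogonalSum,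
      snd_orthogonalSum, snd_orthogonalSum, ho₁, ho₂]

end Product

end Representation

end

theorem proposition5p1
    {E : Type*} [NormedAddCommGroup E] [NormedSpace ℝ E] [FiniteDimensional ℝ E]
    {G : Type*} [Group G] [TopologicalSpace G] [T2Space G] [CompactSpace G]
    [ChartedSpace E G] [LieGroup 𝓘(ℝ, E) ∞ G]
    {V : Type*} [NormedAddCommGroup V] [InnerProductSpace ℝ V] [FiniteDimensional ℝ V]
    (ρ : Representation ℝ G V)
    (hρ_cont : ∀ v : V, Continuous fun g : G => ρ g v)
    (hρ_orth : ∀ (g : G) (v w : V), inner ℝ (ρ g v) (ρ g w) = inner ℝ v w)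
    (V₁ V₂ : Subrepresentation ρ) (hV : IsCompl V₁.toSubmodule V₂.toSubmodule)
    (H₁ H₂ : Subgroup G)
    (hH₁ : V₁.toRepresentation.IsPrincipalIsotropyGroup H₁)
    (hH₂ : V₂.toRepresentation.IsPrincipalIsotropyGroup H₂) :
    ρ.orbitSpaceBoundary.Nonempty ↔
      (Representation.orbitSpaceBoundary
          (V₁.toRepresentation.comp H₂.subtype : Representation ℝ H₂ V₁.toSubmodule)).Nonempty ∨
        (Representation.orbitSpaceBoundary
          (V₂.toRepresentation.comp H₁.subtype : Representation ℝ H₁ V₂.toSubmodule)).Nonempty := by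
  have hcont : ∀ (W : Subrepresentation ρ) (v : W.toSubmodule),
      Continuous fun g : G => W.toRepresentation g v :=
    fun W v => Continuous.subtype_mk (hρ_cont v) _
  have horth : ∀ (W : Subrepresentation ρ) (g : G) (v w : W.toSubmodule),
      inner ℝ (W.toRepresentation g v) (W.toRepresentation g w) = inner ℝ v w :=
    fun W g v w => hρ_orth g v w
  have hmain := Representation.exists_hasCodimOneStratum_orthogonalSum_iff
    (Representation.isCompactOrthogonal_orthogonalSum (hcont V₁) (hcont V₂) (horth V₁) (horth V₂))
    (Representation.isCompactOrthogonal_orthogonalSum (hcont V₂) (hcont V₁) (horth V₂) (horth V₁))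
    hH₁ hH₂
  -- The summands are complementary but need not be orthogonal in V, so `e` is only a linear
  -- equivalence from their orthogonal external sum.
  set e := (WithLp.linearEquiv 2 ℝ (V₁.toSubmodule × V₂.toSubmodule)).trans
    (Submodule.prodEquivOfIsCompl _ _ hV) with he
  have hequiv : ∀ g w, e (Representation.orthogonalSum V₁.toRepresentation V₂.toRepresentation g w)
      = ρ g (e w) := fun g w => (map_add (ρ g) (w.fst : V) (w.snd : V)).symm
  rw [Representation.orbitSpaceBoundary_nonempty_iff,
    Representation.orbitSpaceBoundary_nonempty_iff,
    Representation.orbitSpaceBoundary_nonempty_iff]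
  refine Iff.trans ?_ hmain
  rw [e.surjective.exists]
  exact (exists_congr fun w => Representation.hasCodimOneStratum_of_equivariant e hequiv w)
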